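/- **Setting.** Let $\mathcal X,\mathcal S,\mathcal Y$ be finite alphabets. $\Delta(\cdot)$ denotes the probability simplex, $\tau_{\underline x}$ the type (empirical distribution) of a sequence, $d$ the $\ell^1$ distance; logarithms are to base $2$. An *oblivious AVC* $\mathcal A$ consists of convex sets $\lambda_{\mathbf x}\subseteq\Delta(\mathcal X)$ (input constraints) and $\emptyset\ne\lambda_{\mathbf s}\subseteq\Delta(\mathcal S)$ (state constraints), and a channel $W(y|x,s)$, used memorylessly. Fix a list size $L\ge1$. *CP-symmetrizability.* For $P_{\mathbf x}\in\Delta(\mathcal X)$, $\mathrm{CP}^{\otimes L}(P_{\mathbf x})$ is the set of distributions on $\mathcal X^L$, all of whose one-coordinate marginals are $P_{\mathbf x}$, of the form $\sum_{u\in[k]}P_{\mathbf u}(u)P_{\mathbf x|\mathbf u=u}^{\otimes L}$ with $k\ge1$; the pair $(P_{\mathbf u},P_{\mathbf x|\mathbf u})$ is a CP-decomposition. The pair is *$L$-symmetrizable* if there is $U(s|u,x_1,\dots,x_L)$ such that, for all $u,y,x_0,\dots,x_L$, the sum $\sum_sW(y|x_0,s)U(s|u,x_1,\dots,x_L)$ does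 not change when $(x_0,\dots,x_L)$ is permuted, and the $\mathbf s$-marginal of $P_{\mathbf u}P_{\mathbf x|\mathbf u}^{\otimes L}U$ lies in $\lambda_{\mathbf s}$. $P_{\mathbf x}$ is $L$-symmetrizable if every CP-decomposition of every element of $\mathrm{CP}^{\otimes L}(P_{\mathbf x})$ is. Let $L^*_{\mathrm{cp}}(P_{\mathbf x})$ be the supremum of the $L\ge1$ for which $P_{\mathbf x}$ is $L$-symmetrizable ($0$ if there is none), and $L^*_{\mathrm{cp}}=\inf_{P_{\mathbf x}\in\lambda_{\mathbf x}}L^*_{\mathrm{cp}}(P_{\mathbf x})\in\mathbb N\cup\{\infty\}$. *Capacity expression.* $$C_L=\sup_{(P_{\mathbf u},P_{\mathbf x|\mathbf u})}\ \inf_{U(s|u):\ [P_{\mathbf u}U]_{\mathbf s}\in\lambda_{\mathbf s}} I(\mathbf x;\mathbf y|\mathbf u),$$ where the supremum is over all non-$L$-symmetrizable CP-decompositions of elements of $\mathrm{CP}^{\otimes L}(P_{\mathbf x})$ with $P_{\mathbf x}\in\lambda_{\mathbf x}$, and $I$ is computed from the marginal on $(\mathbf u,\mathbf x,\mathbf y)$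 of $P_{\mathbf u}P_{\mathbf x|\mathbf u}U(s|u)W(y|x,s)$. *Codes and jamming.* A code consists of an encoder $\phi:[M]\to\mathcal X^n$ and an $L$-list-decoder $\psi:\mathcal Y^n\to\{\text{subsets of }[M]\text{ of size}\le L\}$. It is input-feasible if all codewords have type in $\lambda_{\mathbf x}$. Its rate is $\frac1n\log M$, and $P_e(\underline s)$ is the probability, averaged over a uniform message, that the decoded list misses the message when the state sequence is $\underline s$. For $\kappa>0$ call $\underline s\in\mathcal S^n$ *$\kappa$-feasible* if $d(\tau_{\underline s},Q)\le\kappa$ for some $Q\in\lambda_{\mathbf s}$, and let $P^{\kappa}_{e,\mathrm{avg}}=\max P_e(\underline s)$ over $\kappa$-feasible $\underline s$ (for $\kappa=2$ this is the maximum over all of $\mathcal S^n$). Let $C^\kappa_L(\mathcal A)$ be the supremum of all $R$ for which there is a sequence of input-feasible $L$-list-decodable codes of increasing blocklengths, of rate at least $R$, with $P^\kappa_{e,\mathrm{avg}}\to0$. *Conjecture (universal time-sharing), for $\mathcal X$ and $L$.* For all $R\in(0,1]$ and $\varepsilon,\gamma>0$, for all sufficiently small $\lambda>0$ there are $c,\mu>0$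 and $n_0$ such that for all $n\ge n_0$, all $P_{\mathbf x}\in\Delta(\mathcal X)$ and all codes $\mathcal C=\{\underline x_1,\dots,\underline x_M\}\subseteq\mathcal X^n$ of $M\ge|\mathcal X|^{nR}$ distinct words with $d(\tau_{\underline x_i},P_{\mathbf x})\le\lambda$ for all $i$, there are $\tilde P\in\mathrm{CP}^{\otimes L}(P_{\mathbf x})$ and a CP-decomposition $(P_{\mathbf u},P_{\mathbf x|\mathbf u})$ of it over some $[k]$ such that (i) at least $c\binom ML$ of the lists $i_1<\dots<i_L$ satisfy $d(\tau_{\underline x_{i_1},\dots,\underline x_{i_L}},\tilde P)\le\varepsilon$, and (ii) there are a subcode $\mathcal C'\subseteq\mathcal C$ with $|\mathcal C'|\ge\mu M$ and a sequence $\underline u\in[k]^n$ with $d(\tau_{\underline u,\underline x},P_{\mathbf u}P_{\mathbf x|\mathbf u})\le\gamma$ for every $\underline x\in\mathcal C'$. **Theorem (Converse: capacity upper bound).** Assume the conjecture for $\mathcal X$ and $L$, and let $L>L^*_{\mathrm{cp}}$. Then $C^\kappa_L(\mathcal A)\le C_L$ for every $\kappa>0$. More precisely, for all $\kappa,\delta>0$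 there are $c_2>0$ and $n_0$ such that for every $n\ge n_0$ and every input-feasible encoder $\phi:[M]\to\mathcal X^n$ of rate at least $C_L+\delta$ there is a jamming strategy, that is, a probability distribution $q$ on the $\kappa$-feasible sequences of $\mathcal S^n$ (which may depend on $\phi$), such that every $L$-list-decoder $\psi$ has average error $\mathbb E_{\underline s\sim q}[P_e(\underline s)]\ge c_2$; in particular $P^\kappa_{e,\mathrm{avg}}\ge c_2$. -/

import Mathlib

noncomputable section

namespace ObliAVC

/-- The `ℓ¹` distance between two (mass functions of) distributions on a finite set. -/
def l1Dist {α : Type*} [Fintype α] (P Q : α → ℝ) : ℝ := ∑ a, |P a - Q a|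

open Classical in
/-- The type (empirical distribution) of a sequence of length `n`. Joint types are types of
sequences of tuples. -/
def typeOf {n : ℕ} {α : Type*} (x : Fin n → α) : α → ℝ :=
  fun a => ((Finset.univ.filter (fun i => x i = a)).card : ℝ) / n

/-- `K a` is a distribution on `β` for every `a`, i.e. `K ∈ Δ(β | α)`. -/
def IsCondDist {α β : Type*} [Fintype β] (K : α → β → ℝ) : Prop :=
  ∀ a, K a ∈ stdSimplex ℝ β

/-- Conditional mutual information `I(x; y | u)`, in bits, of a joint distribution `P u x y`. -/
def condMutualInfo {U X Y : Type*} [Fintype U] [Fintype X] [Fintype Y] (P : U → X → Y → ℝ) : ℝ :=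
  ∑ u, ∑ x, ∑ y, P u x y *
    Real.logb 2 ((P u x y * ∑ x', ∑ y', P u x' y') / ((∑ y', P u x y') * ∑ x', P u x' y))

/-! ### Completely positive distributions -/

/-- The distribution `∑ u, P(u) P(· | u)^{⊗ L}` on `X ^ L`. -/
def mixPower {X : Type*} (L : ℕ) {k : ℕ} (Pu : Fin k → ℝ) (Pxu : Fin k → X → ℝ) :
    (Fin L → X) → ℝ :=
  fun x => ∑ u, Pu u * ∏ l, Pxu u (x l)

open Classical in
/-- The marginal of a distribution on `X ^ L` on the coordinate `l`. -/
def coordMarginal {X : Type*} [Fintype X] {L : ℕ} (P : (Fin L → X) → ℝ) (l : Fin L) : X → ℝ :=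
  fun a => ∑ x ∈ Finset.univ.filter (fun x : Fin L → X => x l = a), P x

/-- The order-`L` self-couplings of `Px`: distributions on `X ^ L` all of whose one-coordinate
marginals are `Px`. -/
def selfCouplings {X : Type*} [Fintype X] (L : ℕ) (Px : X → ℝ) : Set ((Fin L → X) → ℝ) :=
  {P | P ∈ stdSimplex ℝ (Fin L → X) ∧ ∀ l, coordMarginal P l = Px}

/-- `(Pu, Pxu)` is a CP-decomposition of the distribution `P` on `X ^ L`. -/
def IsCPDecomp {X : Type*} [Fintype X] {L : ℕ} (P : (Fin L → X) → ℝ) {k : ℕ}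
    (Pu : Fin k → ℝ) (Pxu : Fin k → X → ℝ) : Prop :=
  Pu ∈ stdSimplex ℝ (Fin k) ∧ IsCondDist Pxu ∧ P = mixPower L Pu Pxu

/-- The `Px`-completely positive distributions of order `L`. -/
def cpSet {X : Type*} [Fintype X] (L : ℕ) (Px : X → ℝ) : Set ((Fin L → X) → ℝ) :=
  {P | P ∈ selfCouplings L Px ∧
    ∃ (k : ℕ) (Pu : Fin k → ℝ) (Pxu : Fin k → X → ℝ), IsCPDecomp P Pu Pxu}

/-! ### Oblivious arbitrarily varying channels -/

/-- An oblivious AVC with input alphabet `X`, state alphabet `S`, output alphabet `Y`, convex input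
and state constraints and channel law `W x s y = W(y | x, s)`. -/
structure ObliviousAVC (X S Y : Type*) [Fintype X] [Fintype S] [Fintype Y] where
  inputConstr : Set (X → ℝ)
  stateConstr : Set (S → ℝ)
  W : X → S → Y → ℝ
  inputConstr_subset : inputConstr ⊆ stdSimplex ℝ X
  inputConstr_convex : Convex ℝ inputConstr
  stateConstr_subset : stateConstr ⊆ stdSimplex ℝ S
  stateConstr_convex : Convex ℝ stateConstr
  stateConstr_nonempty : stateConstr.Nonempty
  W_mem : ∀ x s, W x s ∈ stdSimplex ℝ Y

/-! ### The combinatorial conjecture -/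

open Classical in
/-- The conjecture on subcodes with a universal time-sharing sequence, for the alphabet `X` and
order `L`. The constants `c`, `μ` do not depend on the blocklength `n` or on the code. A code of
size `M` is listed as `φ 0, …, φ (M - 1)`, its ordered `L`-lists are given by the strictly monotone
maps `Fin L → Fin M`. -/
def SubcodeConjecture (X : Type*) [Fintype X] (L : ℕ) : Prop :=
  ∀ R : ℝ, 0 < R → R ≤ 1 → ∀ ε : ℝ, 0 < ε → ∀ γ : ℝ, 0 < γ →
    ∃ lam₀ : ℝ, 0 < lam₀ ∧ ∀ lam : ℝ, 0 < lam → lam ≤ lam₀ →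
      ∃ c : ℝ, 0 < c ∧ ∃ μ : ℝ, 0 < μ ∧ ∃ n₀ : ℕ, ∀ n : ℕ, n₀ ≤ n →
        ∀ Px ∈ stdSimplex ℝ X, ∀ (M : ℕ) (φ : Fin M → Fin n → X),
          Function.Injective φ →
          (Fintype.card X : ℝ) ^ ((n : ℝ) * R) ≤ (M : ℝ) →
          (∀ m, l1Dist (typeOf (φ m)) Px ≤ lam) →
          ∃ P ∈ cpSet L Px, ∃ (k : ℕ) (Pu : Fin k → ℝ) (Pxu : Fin k → X → ℝ),
            IsCPDecomp P Pu Pxu ∧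
            c * (M.choose L : ℝ) ≤
              ((Finset.univ.filter (fun idx : Fin L → Fin M =>
                StrictMono idx ∧
                  l1Dist (typeOf (fun j : Fin n => fun l : Fin L => φ (idx l) j)) P ≤ ε)).card : ℝ) ∧
            ∃ (C' : Finset (Fin M)) (u : Fin n → Fin k),
              μ * (M : ℝ) ≤ (C'.card : ℝ) ∧
              ∀ m ∈ C', l1Dist (typeOf (fun j : Fin n => (u j, φ m j)))
                (fun a : Fin k × X => Pu a.1 * Pxu a.1 a.2) ≤ γ

namespace ObliviousAVC

variable {X S Y : Type*} [Fintype X] [Fintype S] [Fintype Y] (A : ObliviousAVC X S Y)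

/-! ### CP-symmetrizability -/

/-- Obliviously `L`-symmetrizing conditional distributions `U(s | u, x₁, …, x_L)`: permuting
`x₀, x₁, …, x_L` in any way does not change the law of the output. -/
def IsSymmetrizing (L : ℕ) {k : ℕ} (U : Fin k → (Fin L → X) → S → ℝ) : Prop :=
  (∀ u, IsCondDist (U u)) ∧
  ∀ (u : Fin k) (x : Fin (L + 1) → X) (y : Y) (π : Equiv.Perm (Fin (L + 1))),
    ∑ s, A.W (x 0) s y * U u (fun l => x l.succ) s =
      ∑ s, A.W (x (π 0)) s y * U u (fun l => x (π l.succ)) s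

/-- The pair `(Pu, Pxu)` is `L`-symmetrizable: some symmetrizing distribution induces a state
distribution which satisfies the state constraints. -/
def PairSymmetrizable (L : ℕ) {k : ℕ} (Pu : Fin k → ℝ) (Pxu : Fin k → X → ℝ) : Prop :=
  ∃ U : Fin k → (Fin L → X) → S → ℝ, A.IsSymmetrizing L U ∧
    (fun s => ∑ u, ∑ x : Fin L → X, Pu u * (∏ l, Pxu u (x l)) * U u x s) ∈ A.stateConstr

/-- The input distribution `Px` is obliviously CP-`L`-symmetrizable. -/
def InputSymmetrizable (L : ℕ) (Px : X → ℝ) : Prop :=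
  ∀ P ∈ cpSet L Px, ∀ (k : ℕ) (Pu : Fin k → ℝ) (Pxu : Fin k → X → ℝ),
    IsCPDecomp P Pu Pxu → A.PairSymmetrizable L Pu Pxu

/-- `L*_cp(Px)`, the largest `L ≥ 1` such that `Px` is CP-`L`-symmetrizable (`0` if there is none,
`⊤` if there are arbitrarily large ones). -/
def cpSymmetrizabilityAt (Px : X → ℝ) : ℕ∞ :=
  ⨆ L ∈ {L : ℕ | 1 ≤ L ∧ A.InputSymmetrizable L Px}, (L : ℕ∞)

/-- The CP-symmetrizability `L*_cp` of the AVC. -/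
def cpSymmetrizability : ℕ∞ :=
  ⨅ Px ∈ A.inputConstr, A.cpSymmetrizabilityAt Px

/-! ### The capacity expression -/

/-- The joint distribution of `(u, x, y)` induced by `P(u) P(x | u) U(s | u) W(y | x, s)`. -/
def jointLaw {k : ℕ} (Pu : Fin k → ℝ) (Pxu : Fin k → X → ℝ) (U : Fin k → S → ℝ) :
    Fin k → X → Y → ℝ :=
  fun u x y => ∑ s, Pu u * Pxu u x * U u s * A.W x s y

/-- The expression `C_L`: the supremum, over feasible input distributions `Px` and
non-`L`-symmetrizable CP-decompositions of elements of `cpSet L Px`, of the infimum of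
`I(x; y | u)` over the jamming distributions `U(s | u)` that satisfy the state constraints. -/
def capacityExpr (L : ℕ) : EReal :=
  ⨆ (Px : X → ℝ) (_ : Px ∈ A.inputConstr) (P : (Fin L → X) → ℝ) (_ : P ∈ cpSet L Px)
    (k : ℕ) (Pu : Fin k → ℝ) (Pxu : Fin k → X → ℝ) (_ : IsCPDecomp P Pu Pxu)
    (_ : ¬ A.PairSymmetrizable L Pu Pxu),
    ⨅ (U : Fin k → S → ℝ) (_ : IsCondDist U)
      (_ : (fun s => ∑ u, Pu u * U u s) ∈ A.stateConstr),
      ((condMutualInfo (A.jointLaw Pu Pxu U) : ℝ) : EReal)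

/-! ### Codes, jamming and the operational capacity -/

/-- All codewords of the encoder `φ` satisfy the input constraints. -/
def InputFeasible {n M : ℕ} (φ : Fin M → Fin n → X) : Prop :=
  ∀ m, typeOf (φ m) ∈ A.inputConstr

/-- The state sequence `s` satisfies the state constraints up to `κ`: its type is within `ℓ¹`
distance `κ` of an admissible state distribution. -/
def StateFeasible (κ : ℝ) {n : ℕ} (s : Fin n → S) : Prop :=
  ∃ Q ∈ A.stateConstr, l1Dist (typeOf s) Q ≤ κ

/-- `ψ` is an `L`-list-decoder. -/
def IsListDecoder (L : ℕ) {n M : ℕ} (ψ : (Fin n → Y) → Finset (Fin M)) : Prop :=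
  ∀ y, (ψ y).card ≤ L

open Classical in
/-- The list-decoding error probability, averaged over the messages, for the state sequence `s`. -/
def errorProb {n M : ℕ} (φ : Fin M → Fin n → X) (ψ : (Fin n → Y) → Finset (Fin M))
    (s : Fin n → S) : ℝ :=
  (1 / (M : ℝ)) * ∑ m, ∑ y ∈ Finset.univ.filter (fun y : Fin n → Y => m ∉ ψ y),
    ∏ j, A.W (φ m j) (s j) (y j)

/-- The average probability of error: worst case over the state sequences that satisfy the state
constraints up to `κ` (`0` if there are none). As any two distributions are at distance at most `2`,
the case `κ = 2` is the worst case over all of `S ^ n`. -/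
def avgErrorProb (κ : ℝ) {n M : ℕ} (φ : Fin M → Fin n → X)
    (ψ : (Fin n → Y) → Finset (Fin M)) : ℝ :=
  ⨆ s : {s : Fin n → S // A.StateFeasible κ s}, A.errorProb φ ψ s.1

/-- A (randomized) jamming strategy for blocklength `n`: a probability distribution on `S ^ n`
carried by the sequences that satisfy the state constraints up to `κ`. -/
def IsJammingStrategy (κ : ℝ) {n : ℕ} (q : (Fin n → S) → ℝ) : Prop :=
  q ∈ stdSimplex ℝ (Fin n → S) ∧ ∀ s, q s ≠ 0 → A.StateFeasible κ s

/-- The rate of a code with `M` messages and blocklength `n`, in bits per channel use. -/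
def rate (n M : ℕ) : ℝ := Real.logb 2 M / n

/-- `R` is achievable under `L`-list-decoding when the state constraints are enforced up to `κ`. -/
def Achievable (L : ℕ) (κ R : ℝ) : Prop :=
  ∃ (n M : ℕ → ℕ) (φ : ∀ i, Fin (M i) → Fin (n i) → X)
    (ψ : ∀ i, (Fin (n i) → Y) → Finset (Fin (M i))),
    StrictMono n ∧ (∀ i, 1 ≤ n i) ∧ (∀ i, 1 ≤ M i) ∧
    (∀ i, A.InputFeasible (φ i)) ∧ (∀ i, IsListDecoder L (ψ i)) ∧
    (∀ i, R ≤ rate (n i) (M i)) ∧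
    Filter.Tendsto (fun i => A.avgErrorProb κ (φ i) (ψ i)) Filter.atTop (nhds 0)

/-- The `L`-list-decoding capacity when the state constraints are enforced up to `κ`. -/
def capacity (L : ℕ) (κ : ℝ) : EReal :=
  ⨆ (R : ℝ) (_ : A.Achievable L κ R), (R : EReal)

end ObliviousAVC

end ObliAVC

end

noncomputable section

namespace ObliAVC

/-! The jammer may discard all but a fixed positive fraction μ of the code: a constant error on a
subcode of that density is still a constant error on the whole code. So it suffices to treat one
well-behaved subcode.

Scaled one-hot encoding turns codewords into unit vectors. If some bounded linear functional fails
to concentrate on a family, one of the two halves on either side of its mean has positive density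
and a mean of larger norm. Norms are at most one, so after boundedly many restrictions every bounded
additive statistic of the codewords concentrates (`exists_concentrated_subcode`), at a density
independent of n.

For such a subcode the time-sharing variable is the coordinate j itself, uniform on [n], with the
empirical distribution of column j as conditional input law. This is a CP-decomposition, and its
input marginal is an average of codeword types, hence feasible by convexity. There are two cases
(`exists_stateLaw`). If the pair is symmetrizable, the jammer feeds L random codewords through the
symmetrizing channel. The output law is then symmetric in L+1 messages, which are usually distinct,
and a list of size L must miss one of them. Concentration makes the state type nearly admissible. If
it is not, the pair competes in the supremum defining C_L, so some U(s|j) pushes the mutual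
information below C_L + δ/2. Independent state letters with these laws defeat the code by Fano's
inequality.

Markov's inequality then allows conditioning on κ-feasible sequences at small cost. The assumption L
> L*_cp makes C_L nonnegative rather than the supremum of an empty set. -/

/-! ### Concentration on a subfamily of positive density -/

section Concentration

open scoped RealInnerProductSpace

variable {ι E : Type*} [NormedAddCommGroup E] [InnerProductSpace ℝ E]

/-- The mean of a finite family of vectors. -/
def finsetMean (v : ι → E) (C : Finset ι) : E := (C.card : ℝ)⁻¹ • ∑ i ∈ C, v i

lemma card_smul_finsetMean_sub (v : ι → E) {D : Finset ι} (hD : D.Nonempty) (e : E) :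
    (D.card : ℝ) • (finsetMean v D - e) = ∑ i ∈ D, (v i - e) := by
  have h : (D.card : ℝ) ≠ 0 := by exact_mod_cast hD.card_ne_zero
  rw [smul_sub, finsetMean, smul_smul, mul_inv_cancel₀ h, one_smul, Finset.sum_sub_distrib,
    Finset.sum_const, Nat.cast_smul_eq_nsmul]

lemma sum_sub_finsetMean (v : ι → E) {C : Finset ι} (hC : C.Nonempty) :
    ∑ i ∈ C, (v i - finsetMean v C) = 0 := by
  rw [← card_smul_finsetMean_sub v hC, sub_self, smul_zero]

lemma norm_finsetMean_le {v : ι → E} (hv : ∀ i, ‖v i‖ ≤ 1) (C : Finset ι) :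
    ‖finsetMean v C‖ ≤ 1 := by
  rw [finsetMean, norm_smul, norm_inv, Real.norm_natCast]
  have h : ‖∑ i ∈ C, v i‖ ≤ C.card := by
    simpa using norm_sum_le_of_le C (fun i _ => hv i)
  rw [inv_mul_eq_div]
  exact div_le_one_of_le₀ h (Nat.cast_nonneg _)

/-- If a linear functional of norm at most one does not concentrate on a family, then the mean has
larger norm on some subfamily of positive density. -/
lemma exists_energy_increment {v : ι → E} (hv : ∀ i, ‖v i‖ ≤ 1) {C : Finset ι} (hC : C.Nonempty)
    {w : E} (hw : ‖w‖ ≤ 1) {ε : ℝ} (hε : 0 < ε)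
    (h : ε * C.card < ∑ i ∈ C, |⟪w, v i - finsetMean v C⟫|) :
    ∃ B ⊆ C, B.Nonempty ∧ ε / 4 * C.card ≤ B.card ∧
      ‖finsetMean v C‖ ^ 2 + (ε / 2) ^ 2 ≤ ‖finsetMean v B‖ ^ 2 := by
  classical
  set p := finsetMean v C with hp
  set d : ι → ℝ := fun i => ⟪w, v i - p⟫ with hd
  have hcard : (0 : ℝ) < C.card := by exact_mod_cast hC.card_pos
  have hd2 : ∀ i, |d i| ≤ 2 := fun i => by
    have h1 : ‖v i - p‖ ≤ 2 := (norm_sub_le _ _).trans (by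
      have := norm_finsetMean_le hv C
      have := hv i
      linarith)
    calc |d i| ≤ ‖w‖ * ‖v i - p‖ := abs_real_inner_le_norm _ _
      _ ≤ 1 * 2 := mul_le_mul hw h1 (norm_nonneg _) zero_le_one
      _ = 2 := one_mul 2
  -- Since |d| ≤ 2, a large partial sum forces both many indices and a displaced mean.
  have key : ∀ D ⊆ C, ε / 2 * C.card < |∑ i ∈ D, d i| →
      D.Nonempty ∧ ε / 4 * C.card ≤ D.card ∧ ε / 2 ≤ ‖finsetMean v D - p‖ := by
    intro D hDC hD
    have hne : D.Nonempty := by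
      rw [Finset.nonempty_iff_ne_empty]
      rintro rfl
      simp only [Finset.sum_empty, abs_zero] at hD
      nlinarith
    have hDpos : (0 : ℝ) < D.card := by exact_mod_cast hne.card_pos
    have hDle : (D.card : ℝ) ≤ C.card := by exact_mod_cast Finset.card_le_card hDC
    have h1 : |∑ i ∈ D, d i| ≤ D.card * 2 := by
      refine (Finset.abs_sum_le_sum_abs _ _).trans ?_
      simpa using Finset.sum_le_card_nsmul D (fun i => |d i|) 2 (fun i _ => hd2 i)
    have h2 : |∑ i ∈ D, d i| ≤ D.card * ‖finsetMean v D - p‖ := by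
      have : ∑ i ∈ D, d i = ⟪w, (D.card : ℝ) • (finsetMean v D - p)⟫ := by
        rw [card_smul_finsetMean_sub v hne, inner_sum]
      rw [this]
      refine (abs_real_inner_le_norm _ _).trans ?_
      rw [norm_smul, Real.norm_natCast]
      exact mul_le_of_le_one_left (by positivity) hw
    refine ⟨hne, by linarith, ?_⟩
    by_contra! hlt
    have : (D.card : ℝ) * ‖finsetMean v D - p‖ ≤ C.card * (ε / 2) :=
      mul_le_mul hDle hlt.le (norm_nonneg _) hcard.le
    linarith
  have hsq : ∀ D : Finset ι, 0 ≤ ⟪p, finsetMean v D - p⟫ → ε / 2 ≤ ‖finsetMean v D - p‖ →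
      ‖p‖ ^ 2 + (ε / 2) ^ 2 ≤ ‖finsetMean v D‖ ^ 2 := by
    intro D h1 h2
    have := norm_add_sq_real p (finsetMean v D - p)
    rw [add_sub_cancel] at this
    rw [this]
    have := pow_le_pow_left₀ (by positivity) h2 2
    linarith
  set B := C.filter (fun i => 0 ≤ d i) with hB
  set B' := C.filter (fun i => ¬ 0 ≤ d i) with hB'
  have hsum0 : ∑ i ∈ B, d i + ∑ i ∈ B', d i = 0 := by
    rw [Finset.sum_filter_add_sum_filter_not, hd]
    simp only
    rw [← inner_sum, sum_sub_finsetMean v hC, inner_zero_right]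
  have habs : ∑ i ∈ B, d i - ∑ i ∈ B', d i = ∑ i ∈ C, |d i| := by
    rw [← Finset.sum_filter_add_sum_filter_not C (fun i => 0 ≤ d i), sub_eq_add_neg,
      ← Finset.sum_neg_distrib]
    congr 1
    · exact Finset.sum_congr rfl fun i hi => (abs_of_nonneg (Finset.mem_filter.1 hi).2).symm
    · exact Finset.sum_congr rfl fun i hi =>
        (abs_of_neg (not_le.1 (Finset.mem_filter.1 hi).2)).symm
  obtain ⟨n1, c1, e1⟩ := key B (Finset.filter_subset _ _)
    (lt_of_lt_of_le (by linarith) (le_abs_self _))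
  obtain ⟨n2, c2, e2⟩ := key B' (Finset.filter_subset _ _)
    (lt_of_lt_of_le (by linarith) (neg_le_abs _))
  -- The size-weighted displacements of the two halves cancel, so one of them has nonnegative inner
  -- product with `p`. For that half the expansion in `hsq` gains the full squared displacement.
  have hbal : (B.card : ℝ) * ⟪p, finsetMean v B - p⟫ + B'.card * ⟪p, finsetMean v B' - p⟫ = 0 := by
    rw [← real_inner_smul_right, ← real_inner_smul_right, card_smul_finsetMean_sub v n1,
      card_smul_finsetMean_sub v n2, ← inner_add_right, Finset.sum_filter_add_sum_filter_not,
      sum_sub_finsetMean v hC, inner_zero_right]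
  by_cases hs : 0 ≤ ⟪p, finsetMean v B - p⟫
  · exact ⟨B, Finset.filter_subset _ _, n1, c1, hsq B hs e1⟩
  · refine ⟨B', Finset.filter_subset _ _, n2, c2, hsq B' ?_ e2⟩
    have h1 : (0 : ℝ) < B.card := by exact_mod_cast n1.card_pos
    have h2 : (0 : ℝ) < B'.card := by exact_mod_cast n2.card_pos
    by_contra! h3
    nlinarith

/-- Every finite family in the unit ball has a subfamily, of density bounded below in terms of `ε`
only, on which all linear functionals of norm at most one concentrate around their mean. -/
lemma exists_concentrated_subset {v : ι → E} (hv : ∀ i, ‖v i‖ ≤ 1) {C : Finset ι}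
    (hC : C.Nonempty) {ε : ℝ} (hε : 0 < ε) :
    ∃ B ⊆ C, B.Nonempty ∧ (min (ε / 4) 1) ^ ⌈1 / (ε / 2) ^ 2⌉₊ * C.card ≤ B.card ∧
      ∀ w : E, ‖w‖ ≤ 1 → ∑ i ∈ B, |⟪w, v i - finsetMean v B⟫| ≤ ε * B.card := by
  -- `k` bounds the number of increments still available: at `k = 0` the mean already has norm one.
  -- The minimum with 1 keeps the density bound valid when the iteration stops early.
  have main : ∀ (k : ℕ) (C : Finset ι), C.Nonempty →
      1 - k * (ε / 2) ^ 2 ≤ ‖finsetMean v C‖ ^ 2 →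
      ∃ B ⊆ C, B.Nonempty ∧ (min (ε / 4) 1) ^ k * C.card ≤ B.card ∧
        ∀ w : E, ‖w‖ ≤ 1 → ∑ i ∈ B, |⟪w, v i - finsetMean v B⟫| ≤ ε * B.card := by
    intro k
    have hε2 : 0 < (ε / 2) ^ 2 := by positivity
    induction k with
    | zero =>
      intro C hC hk
      refine ⟨C, subset_rfl, hC, by simp, fun w hw => ?_⟩
      by_contra! hlt
      obtain ⟨B, -, -, -, hB⟩ := exists_energy_increment hv hC hw hε hlt
      have := pow_le_one₀ (norm_nonneg _) (norm_finsetMean_le hv B) (n := 2)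
      simp only [Nat.cast_zero, zero_mul, sub_zero] at hk
      linarith
    | succ k ih =>
      intro C hC hk
      have hm : 0 ≤ min (ε / 4) 1 := by positivity
      by_cases hall : ∀ w : E, ‖w‖ ≤ 1 →
          ∑ i ∈ C, |⟪w, v i - finsetMean v C⟫| ≤ ε * C.card
      · exact ⟨C, subset_rfl, hC, mul_le_of_le_one_left (Nat.cast_nonneg _)
          (pow_le_one₀ hm (min_le_right _ _)), hall⟩
      · push Not at hall
        obtain ⟨w, hw, hlt⟩ := hall
        obtain ⟨B, hBC, hB, hcard, hen⟩ := exists_energy_increment hv hC hw hε hlt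
        obtain ⟨D, hDB, hD, hDc, hDw⟩ := ih B hB (by push_cast at hk; linarith)
        refine ⟨D, hDB.trans hBC, hD, le_trans ?_ hDc, hDw⟩
        rw [pow_succ, mul_assoc]
        refine mul_le_mul_of_nonneg_left (le_trans ?_ hcard) (pow_nonneg hm _)
        exact mul_le_mul_of_nonneg_right (min_le_left _ _) (Nat.cast_nonneg _)
  refine main _ C hC ?_
  have h1 := Nat.le_ceil (1 / (ε / 2) ^ 2)
  rw [div_le_iff₀ (by positivity)] at h1
  have := sq_nonneg ‖finsetMean v C‖
  linarith

end Concentration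

/-! ### Codes with concentrated empirical sums -/

section Code

variable {ι X : Type*} [Fintype ι]

open Classical in
/-- The empirical distribution of the column `j` of a code. -/
def colDist {n : ℕ} (φ : ι → Fin n → X) (j : Fin n) (a : X) : ℝ :=
  ((Finset.univ.filter (fun m => φ m j = a)).card : ℝ) / Fintype.card ι

lemma colDist_nonneg {n : ℕ} (φ : ι → Fin n → X) (j : Fin n) (a : X) : 0 ≤ colDist φ j a := by
  unfold colDist; positivity

variable [Fintype X]

lemma sum_colDist_mul {n : ℕ} (φ : ι → Fin n → X) (j : Fin n) (f : X → ℝ) :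
    ∑ a, colDist φ j a * f a = (Fintype.card ι : ℝ)⁻¹ * ∑ m, f (φ m j) := by
  classical
  have : ∀ a, colDist φ j a * f a
      = (Fintype.card ι : ℝ)⁻¹ * ∑ m, if φ m j = a then f a else 0 := fun a => by
    rw [← Finset.sum_filter, Finset.sum_const, nsmul_eq_mul, colDist]
    ring_nf
  simp_rw [this, ← Finset.mul_sum]
  rw [Finset.sum_comm]
  simp

lemma colDist_mem_stdSimplex [Nonempty ι] {n : ℕ} (φ : ι → Fin n → X) (j : Fin n) :
    colDist φ j ∈ stdSimplex ℝ X := by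
  refine ⟨colDist_nonneg φ j, ?_⟩
  have := sum_colDist_mul φ j (fun _ => 1)
  simpa using this

/-- The sums `∑ j, w j (x j)` with weights at most one in modulus concentrate around their mean as
`x` ranges over the code. -/
def Concentrated {n : ℕ} (ε : ℝ) (φ : ι → Fin n → X) : Prop :=
  ∀ w : Fin n → X → ℝ, (∀ j a, |w j a| ≤ 1) →
    ∑ m, |∑ j, (w j (φ m j) - ∑ a, colDist φ j a * w j a)| ≤ ε * n * Fintype.card ι

lemma sum_fin_succ_fun {α : Type*} [Fintype α] {β : Type*} [AddCommMonoid β] {L : ℕ}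
    (f : (Fin (L + 1) → α) → β) :
    ∑ x, f x = ∑ y : Fin L → α, ∑ a, f (Fin.cons a y) := by
  rw [Finset.sum_comm, ← Fintype.sum_prod_type', ← (Fin.consEquiv (fun _ => α)).sum_comp]
  rfl

/-- Codewords are averaged out one at a time. With the others frozen, `G` is a bounded weight in a
single letter, so the definition applies at cost `ε * n`; the average `G'` is again bounded by one.
Lists are drawn with repetition, which keeps the entries independent. -/
lemma Concentrated.sum_abs_le {n : ℕ} {ε : ℝ} {φ : ι → Fin n → X} [Nonempty ι]
    (hφ : Concentrated ε φ) :
    ∀ (L : ℕ) (G : Fin n → (Fin L → X) → ℝ), (∀ j x, |G j x| ≤ 1) →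
      ∑ m : Fin L → ι, |∑ j, (G j (fun l => φ (m l) j)
        - ∑ x : Fin L → X, (∏ l, colDist φ j (x l)) * G j x)|
          ≤ L * (ε * n) * (Fintype.card ι : ℝ) ^ L
  | 0, G, hG => by
    have : ∀ (m : Fin 0 → ι) (j : Fin n), (fun l => φ (m l) j) = (default : Fin 0 → X) :=
      fun m j => Subsingleton.elim _ _
    simp [this]
  | L + 1, G, hG => by
    set G' : Fin n → (Fin L → X) → ℝ := fun j x => ∑ a, colDist φ j a * G j (Fin.cons a x)
      with hG'
    have hG'1 : ∀ j x, |G' j x| ≤ 1 := fun j x => by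
      calc |G' j x| ≤ ∑ a, |colDist φ j a * G j (Fin.cons a x)| := Finset.abs_sum_le_sum_abs _ _
        _ ≤ ∑ a, colDist φ j a := Finset.sum_le_sum fun a _ => by
            rw [abs_mul, abs_of_nonneg (colDist_nonneg φ j a)]
            exact mul_le_of_le_one_right (colDist_nonneg φ j a) (hG _ _)
        _ = 1 := (colDist_mem_stdSimplex φ j).2
    have hmean : ∀ j, ∑ x : Fin (L + 1) → X, (∏ l, colDist φ j (x l)) * G j x
        = ∑ x : Fin L → X, (∏ l, colDist φ j (x l)) * G' j x := fun j => by
      rw [sum_fin_succ_fun]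
      refine Finset.sum_congr rfl fun x _ => ?_
      rw [hG', Finset.mul_sum]
      refine Finset.sum_congr rfl fun a _ => ?_
      rw [Fin.prod_univ_succ]
      simp only [Fin.cons_zero, Fin.cons_succ]
      ring
    have hcons : ∀ (m : Fin L → ι) (i : ι) (j : Fin n),
        (fun l => φ ((Fin.cons i m : Fin (L + 1) → ι) l) j)
          = (Fin.cons (φ i j) (fun l => φ (m l) j) : Fin (L + 1) → X) := fun m i j => by
      funext l
      refine Fin.cases ?_ (fun l => ?_) l <;> simp
    have ih := Concentrated.sum_abs_le hφ L G' hG'1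
    rw [sum_fin_succ_fun]
    calc _ ≤ ∑ m : Fin L → ι, ∑ i : ι,
          (|∑ j, (G j (Fin.cons (φ i j) (fun l => φ (m l) j)) - G' j (fun l => φ (m l) j))|
          + |∑ j, (G' j (fun l => φ (m l) j)
            - ∑ x : Fin L → X, (∏ l, colDist φ j (x l)) * G' j x)|) := by
          refine Finset.sum_le_sum fun m _ => Finset.sum_le_sum fun i _ => ?_
          refine le_trans (le_of_eq ?_) (abs_add_le _ _)
          rw [← Finset.sum_add_distrib]
          congr 1
          refine Finset.sum_congr rfl fun j _ => ?_
          rw [hmean, hcons]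
          ring
      _ ≤ ∑ m : Fin L → ι, (ε * n * Fintype.card ι
          + Fintype.card ι * |∑ j, (G' j (fun l => φ (m l) j)
            - ∑ x : Fin L → X, (∏ l, colDist φ j (x l)) * G' j x)|) := by
          refine Finset.sum_le_sum fun m _ => ?_
          rw [Finset.sum_add_distrib, Finset.sum_const, Finset.card_univ, nsmul_eq_mul]
          gcongr
          exact hφ (fun j a => G j (Fin.cons a (fun l => φ (m l) j))) (fun j a => hG _ _)
      _ ≤ _ := by
          rw [Finset.sum_add_distrib, ← Finset.mul_sum, Finset.sum_const, Finset.card_univ,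
            Fintype.card_fun, Fintype.card_fin, nsmul_eq_mul]
          have := mul_le_mul_of_nonneg_left ih (Nat.cast_nonneg (α := ℝ) (Fintype.card ι))
          rw [Finset.mul_sum] at this
          push_cast
          rw [pow_succ, ← Finset.mul_sum, Finset.mul_sum]
          linarith

/-- Every code has a concentrated subcode of density bounded below independently of the
blocklength. -/
lemma exists_concentrated_subcode [Nonempty ι] {n : ℕ} (hn : 1 ≤ n) (φ : ι → Fin n → X) {ε : ℝ}
    (hε : 0 < ε) :
    ∃ B : Finset ι, B.Nonempty ∧
      (min (ε / 4) 1) ^ ⌈1 / (ε / 2) ^ 2⌉₊ * (Fintype.card ι : ℝ) ≤ B.card ∧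
      Concentrated (ε * Fintype.card X) (fun m : B => φ m) := by
  classical
  have hn0 : (0 : ℝ) < n := by exact_mod_cast hn
  have : Nonempty X := ⟨φ (Classical.arbitrary ι) ⟨0, hn⟩⟩
  have hX : (1 : ℝ) ≤ Fintype.card X := by exact_mod_cast Fintype.card_pos
  set v : ι → EuclideanSpace ℝ (Fin n × X) := fun m =>
    WithLp.toLp 2 (fun p => if φ m p.1 = p.2 then (√n)⁻¹ else 0) with hv
  have hv1 : ∀ m, ‖v m‖ ≤ 1 := fun m => by
    rw [EuclideanSpace.norm_eq, Real.sqrt_le_one]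
    simp only [hv, Fintype.sum_prod_type]
    have : ∀ j : Fin n, ∑ a, ‖(if φ m j = a then (√n)⁻¹ else 0 : ℝ)‖ ^ 2 = (n : ℝ)⁻¹ := fun j => by
      rw [Finset.sum_eq_single (φ m j)]
      · simp [Real.sq_sqrt hn0.le]
      · intro b _ hb; simp [hb.symm]
      · simp
    rw [Finset.sum_congr rfl fun j _ => this j]
    simp [hn0.ne']
  obtain ⟨B, -, hB, hcard, hw⟩ := exists_concentrated_subset hv1 Finset.univ_nonempty hε
  refine ⟨B, hB, by simpa using hcard, fun w hw1 => ?_⟩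
  -- The factor `Fintype.card X` brings the norm below one and reappears in the concentration
  -- constant.
  set w' : EuclideanSpace ℝ (Fin n × X) :=
    WithLp.toLp 2 (fun p => w p.1 p.2 / (√n * Fintype.card X)) with hw'
  have hw'1 : ‖w'‖ ≤ 1 := by
    rw [EuclideanSpace.norm_eq, Real.sqrt_le_one]
    calc ∑ i, ‖w' i‖ ^ 2 ≤ ∑ _i : Fin n × X, 1 / (n * (Fintype.card X : ℝ) ^ 2) := by
          refine Finset.sum_le_sum fun p _ => ?_
          rw [Real.norm_eq_abs, sq_abs, hw']
          simp only
          rw [div_pow, mul_pow, Real.sq_sqrt hn0.le, ← sq_abs]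
          gcongr
          exact pow_le_one₀ (abs_nonneg _) (hw1 _ _)
      _ = 1 / Fintype.card X := by
          rw [Finset.sum_const, Finset.card_univ, Fintype.card_prod, Fintype.card_fin,
            nsmul_eq_mul]
          push_cast
          field_simp
      _ ≤ 1 := by rw [div_le_one (by linarith)]; exact hX
  have hinner : ∀ m, inner ℝ w' (v m) = (∑ j, w j (φ m j)) / (n * Fintype.card X) := fun m => by
    rw [PiLp.inner_apply, Fintype.sum_prod_type, Finset.sum_div]
    refine Finset.sum_congr rfl fun j _ => ?_
    rw [Finset.sum_eq_single (φ m j)]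
    · simp only [hv, hw', if_true]
      simp only [RCLike.inner_apply, conj_trivial]
      have h2 : √(n : ℝ) ≠ 0 := by positivity
      field_simp
      rw [Real.sq_sqrt hn0.le, mul_comm]
    · intro b _ hb; simp [hv, hb.symm]
    · simp
  have hsub : ∀ m, inner ℝ w' (v m - finsetMean v B)
      = (∑ j, (w j (φ m j) - ∑ a, colDist (fun m : B => φ m) j a * w j a))
        / (n * Fintype.card X) := fun m => by
    rw [inner_sub_right, hinner, finsetMean, real_inner_smul_right, inner_sum,
      Finset.sum_sub_distrib, sub_div]
    simp_rw [hinner, sum_colDist_mul]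
    rw [← Finset.sum_div, ← Finset.mul_sum, Finset.sum_comm (s := Finset.univ),
      Finset.sum_coe_sort B (fun m => ∑ j, w j (φ m j)), Fintype.card_coe]
    ring
  have h := hw w' hw'1
  have hpos : (0 : ℝ) < n * Fintype.card X := by positivity
  simp_rw [hsub, abs_div, abs_of_pos hpos] at h
  rw [← Finset.sum_div, div_le_iff₀ hpos] at h
  rw [Finset.sum_coe_sort B (fun m => |∑ j, (w j (φ m j)
    - ∑ a, colDist (fun m : B => φ m) j a * w j a)|), Fintype.card_coe]
  linarith

end Code

/-! ### Product laws and jamming strategies -/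

section ProductLaw

variable {S : Type*} [Fintype S]

lemma sum_prod_eq_prod_sum {n : ℕ} (V : Fin n → S → ℝ) :
    ∑ s : Fin n → S, ∏ j, V j (s j) = ∏ j, ∑ a, V j a := by
  classical
  rw [Finset.prod_univ_sum, Fintype.piFinset_univ]

lemma prodLaw_mem_stdSimplex {n : ℕ} {V : Fin n → S → ℝ} (hV : IsCondDist V) :
    (fun s : Fin n → S => ∏ j, V j (s j)) ∈ stdSimplex ℝ (Fin n → S) := by
  refine ⟨fun s => Finset.prod_nonneg fun j _ => (hV j).1 _, ?_⟩
  rw [sum_prod_eq_prod_sum]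
  exact Finset.prod_eq_one fun j _ => (hV j).2

/-- The second moment of a sum of independent centered variables bounded by one. -/
lemma sum_prod_mul_sq_le : ∀ {n : ℕ} {V : Fin n → S → ℝ} (_ : IsCondDist V)
    {h : Fin n → S → ℝ} (_ : ∀ j a, |h j a| ≤ 1) (_ : ∀ j, ∑ a, V j a * h j a = 0),
    ∑ s : Fin n → S, (∏ j, V j (s j)) * (∑ j, h j (s j)) ^ 2 ≤ n
  | 0, V, _, h, _, _ => by simp
  | n + 1, V, hV, h, hh, h0 => by
    have hV' : IsCondDist (fun j : Fin n => V j.succ) := fun j => hV _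
    have ih := sum_prod_mul_sq_le hV' (h := fun j => h j.succ) (fun j a => hh _ _) (fun j => h0 _)
    have h1 := (prodLaw_mem_stdSimplex hV').2
    have hq := (prodLaw_mem_stdSimplex hV').1
    rw [sum_fin_succ_fun]
    calc _ ≤ ∑ s : Fin n → S, (∏ j, V j.succ (s j)) * (1 + (∑ j, h j.succ (s j)) ^ 2) := by
          refine Finset.sum_le_sum fun s _ => ?_
          have hsq : ∑ a, V 0 a * h 0 a ^ 2 ≤ 1 := by
            rw [← (hV 0).2]
            refine Finset.sum_le_sum fun a _ => mul_le_of_le_one_right ((hV 0).1 a) ?_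
            rw [← sq_abs]
            exact pow_le_one₀ (abs_nonneg _) (hh _ _)
          set R := ∑ j, h j.succ (s j)
          set q := ∏ j, V j.succ (s j) with hqs
          calc _ = ∑ a, q * (V 0 a * h 0 a ^ 2 + 2 * R * (V 0 a * h 0 a) + R ^ 2 * V 0 a) := by
                refine Finset.sum_congr rfl fun a _ => ?_
                rw [Fin.prod_univ_succ, Fin.sum_univ_succ]
                simp only [Fin.cons_zero, Fin.cons_succ]
                ring
            _ = q * (∑ a, V 0 a * h 0 a ^ 2 + R ^ 2) := by
                rw [← Finset.mul_sum, Finset.sum_add_distrib, Finset.sum_add_distrib,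
                  ← Finset.mul_sum, ← Finset.mul_sum, h0, (hV 0).2]
                ring
            _ ≤ _ := mul_le_mul_of_nonneg_left (by linarith) (hq s)
      _ = 1 + ∑ s : Fin n → S, (∏ j, V j.succ (s j)) * (∑ j, h j.succ (s j)) ^ 2 := by
          simp_rw [mul_add, mul_one, Finset.sum_add_distrib]
          rw [h1]
      _ ≤ _ := by push_cast; linarith

lemma typeOf_eq_sum {n : ℕ} {α : Type*} [DecidableEq α] (x : Fin n → α) (a : α) :
    typeOf x a = (n : ℝ)⁻¹ * ∑ j, if x j = a then (1 : ℝ) else 0 := by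
  rw [typeOf, Finset.sum_boole, div_eq_inv_mul]
  congr!

lemma l1Dist_triangle {α : Type*} [Fintype α] (P Q R : α → ℝ) :
    l1Dist P R ≤ l1Dist P Q + l1Dist Q R := by
  unfold l1Dist
  rw [← Finset.sum_add_distrib]
  exact Finset.sum_le_sum fun a _ => abs_sub_le _ _ _

/-- The type of a sequence of independent letters is close to the average of their laws. -/
lemma sum_prod_mul_l1Dist_le {n : ℕ} (hn : 1 ≤ n) {V : Fin n → S → ℝ} (hV : IsCondDist V) :
    ∑ s : Fin n → S, (∏ j, V j (s j)) * l1Dist (typeOf s) (fun a => (n : ℝ)⁻¹ * ∑ j, V j a)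
      ≤ Fintype.card S / √n := by
  classical
  have hn0 : (0 : ℝ) < n := by exact_mod_cast hn
  have hsn : (0 : ℝ) < √n := Real.sqrt_pos.2 hn0
  have hss : √(n : ℝ) * √n = n := Real.mul_self_sqrt hn0.le
  obtain ⟨hq, hq1⟩ := prodLaw_mem_stdSimplex hV
  have key : ∀ a : S, ∑ s : Fin n → S, (∏ j, V j (s j)) *
      |typeOf s a - (n : ℝ)⁻¹ * ∑ j, V j a| ≤ 1 / √n := by
    intro a
    set h : Fin n → S → ℝ := fun j b => (if b = a then 1 else 0) - V j a with hh
    have hVa : ∀ j, 0 ≤ V j a ∧ V j a ≤ 1 := fun j =>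
      ⟨(hV j).1 a, (hV j).2 ▸ Finset.single_le_sum (fun b _ => (hV j).1 b) (Finset.mem_univ a)⟩
    have h1 : ∀ j b, |h j b| ≤ 1 := fun j b => by
      have := hVa j
      simp only [hh]
      rw [abs_le]
      split_ifs <;> constructor <;> linarith
    have h0 : ∀ j, ∑ b, V j b * h j b = 0 := fun j => by
      simp only [hh, mul_sub, Finset.sum_sub_distrib, ← Finset.sum_mul, (hV j).2]
      simp
    have h2 := sum_prod_mul_sq_le hV h1 h0
    -- AM–GM at the scale `√n` of the standard deviation, in place of Cauchy–Schwarz.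
    calc _ ≤ ∑ s : Fin n → S, (∏ j, V j (s j)) *
          ((n : ℝ)⁻¹ * (((∑ j, h j (s j)) ^ 2 / √n + √n) / 2)) := by
          refine Finset.sum_le_sum fun s _ => mul_le_mul_of_nonneg_left ?_ (hq s)
          rw [typeOf_eq_sum, ← mul_sub, ← Finset.sum_sub_distrib, abs_mul,
            abs_of_pos (inv_pos.2 hn0)]
          refine mul_le_mul_of_nonneg_left ?_ (inv_pos.2 hn0).le
          change |∑ j, h j (s j)| ≤ _
          set t := ∑ j, h j (s j)
          rw [le_div_iff₀ two_pos, div_add' _ _ _ hsn.ne', le_div_iff₀ hsn, ← sq_abs t]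
          nlinarith [sq_nonneg (|t| - √n)]
      _ = (n : ℝ)⁻¹ * ((∑ s : Fin n → S, (∏ j, V j (s j)) * (∑ j, h j (s j)) ^ 2) / √n / 2
          + √n / 2 * ∑ s : Fin n → S, (∏ j, V j (s j))) := by
          rw [Finset.sum_div, Finset.sum_div, Finset.mul_sum, ← Finset.sum_add_distrib,
            Finset.mul_sum]
          exact Finset.sum_congr rfl fun s _ => by ring
      _ ≤ (n : ℝ)⁻¹ * (n / √n / 2 + √n / 2 * 1) := by
          rw [hq1]
          gcongr
      _ = 1 / √n := by
          field_simp; rw [Real.sq_sqrt hn0.le]; ring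
  unfold l1Dist
  simp_rw [Finset.mul_sum]
  rw [Finset.sum_comm]
  simp_rw [← Finset.mul_sum]
  refine (Finset.sum_le_sum fun a _ => key a).trans ?_
  rw [Finset.sum_const, Finset.card_univ, nsmul_eq_mul, mul_one_div]

end ProductLaw

namespace ObliviousAVC

variable {X S Y : Type*} [Fintype X] [Fintype S] [Fintype Y] (A : ObliviousAVC X S Y)

/-- A law of the state sequence whose type is close, on average, to an admissible state distribution
can be conditioned on feasibility. -/
lemma exists_isJammingStrategy {n : ℕ} {κ η : ℝ} (hκ : 0 < κ) (hη : η < 1)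
    {q : (Fin n → S) → ℝ} (hq : q ∈ stdSimplex ℝ (Fin n → S)) {Q : S → ℝ}
    (hQ : Q ∈ A.stateConstr) (h : ∑ s, q s * l1Dist (typeOf s) Q ≤ η * κ) :
    ∃ q' : (Fin n → S) → ℝ, A.IsJammingStrategy κ q' ∧
      ∀ e : (Fin n → S) → ℝ, (∀ s, 0 ≤ e s) → (∀ s, e s ≤ 1) →
        ∑ s, q s * e s - η ≤ ∑ s, q' s * e s := by
  classical
  set F : Finset (Fin n → S) := Finset.univ.filter (fun s => A.StateFeasible κ s) with hF
  -- Markov: an infeasible sequence is farther than `κ` from `Q` in particular.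
  have hinf : ∑ s ∈ Fᶜ, q s ≤ η := by
    refine le_of_mul_le_mul_right (le_trans ?_ h) hκ
    rw [Finset.sum_mul]
    calc ∑ s ∈ Fᶜ, q s * κ ≤ ∑ s ∈ Fᶜ, q s * l1Dist (typeOf s) Q := by
          refine Finset.sum_le_sum fun s hs => mul_le_mul_of_nonneg_left ?_ (hq.1 s)
          simp only [hF, Finset.mem_compl, Finset.mem_filter, Finset.mem_univ, true_and] at hs
          by_contra! hlt
          exact hs ⟨Q, hQ, hlt.le⟩
      _ ≤ _ := Finset.sum_le_univ_sum_of_nonneg fun s =>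
          mul_nonneg (hq.1 s) (Finset.sum_nonneg fun _ _ => abs_nonneg _)
  have hsplit : ∀ f : (Fin n → S) → ℝ, ∑ s ∈ F, f s + ∑ s ∈ Fᶜ, f s = ∑ s, f s :=
    fun f => Finset.sum_add_sum_compl F f
  set p := ∑ s ∈ F, q s with hp
  have hp1 : p ≤ 1 := by
    rw [← hq.2]; exact Finset.sum_le_univ_sum_of_nonneg hq.1
  have hp0 : 0 < p := by
    have := hsplit q
    rw [hq.2] at this
    linarith
  have hsum : ∀ e : (Fin n → S) → ℝ,
      ∑ s, (if s ∈ F then q s / p else 0) * e s = (∑ s ∈ F, q s * e s) / p := fun e => by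
    simp_rw [ite_mul, zero_mul]
    rw [Finset.sum_ite_mem, Finset.univ_inter, Finset.sum_div]
    exact Finset.sum_congr rfl fun s _ => by ring
  refine ⟨fun s => if s ∈ F then q s / p else 0, ⟨⟨fun s => ?_, ?_⟩, fun s hs => ?_⟩,
    fun e he0 he1 => ?_⟩
  · dsimp only
    split_ifs
    · exact div_nonneg (hq.1 s) hp0.le
    · exact le_rfl
  · have := hsum (fun _ => 1)
    simp only [mul_one] at this
    rw [this, div_self hp0.ne']
  · by_contra hns
    exact hs (if_neg fun hm => hns (Finset.mem_filter.1 hm).2)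
  · rw [hsum]
    have h1 : ∑ s ∈ Fᶜ, q s * e s ≤ ∑ s ∈ Fᶜ, q s :=
      Finset.sum_le_sum fun s _ => mul_le_of_le_one_right (hq.1 s) (he1 s)
    have h2 : ∑ s ∈ F, q s * e s ≤ (∑ s ∈ F, q s * e s) / p :=
      le_div_self (Finset.sum_nonneg fun s _ => mul_nonneg (hq.1 s) (he0 s)) hp0 hp1
    have := hsplit (fun s => q s * e s)
    linarith

end ObliviousAVC

/-! ### Mutual information and Fano's inequality -/

section Information

/-- This is log x ≤ x − 1 at x = rg/p, the pointwise variational bound for divergence. The test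
value `g` is free: `g = 1` gives nonnegativity of mutual information, and M/L on decoded messages
gives Fano's inequality. -/
lemma mul_log_add_sub_le {p r g : ℝ} (hp : 0 ≤ p) (hr : 0 ≤ r) (hpr : r = 0 → p = 0)
    (hg : 0 < g) : p * Real.log g + p - r * g ≤ p * Real.log (p / r) := by
  rcases hp.eq_or_lt with rfl | hp
  · simp only [zero_mul, zero_add, zero_sub]
    have := mul_nonneg hr hg.le
    linarith
  have hr : 0 < r := lt_of_le_of_ne hr fun h => hp.ne' (hpr h.symm)
  have h1 := Real.log_le_sub_one_of_pos (show 0 < r * g / p by positivity)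
  rw [Real.log_div (by positivity) hp.ne', Real.log_mul hr.ne' hg.ne'] at h1
  rw [Real.log_div hp.ne' hr.ne']
  have h2 := mul_le_mul_of_nonneg_left h1 hp.le
  have h3 : p * (r * g / p - 1) = r * g - p := by field_simp
  rw [h3] at h2
  linarith

lemma condMutualInfo_nonneg {U X Y : Type*} [Fintype U] [Fintype X] [Fintype Y]
    {P : U → X → Y → ℝ} (hP : ∀ u x y, 0 ≤ P u x y) : 0 ≤ condMutualInfo P := by
  refine Finset.sum_nonneg fun u _ => ?_
  set c := ∑ x, ∑ y, P u x y with hc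
  set a : X → ℝ := fun x => ∑ y, P u x y with ha
  set b : Y → ℝ := fun y => ∑ x, P u x y with hb
  have hbc : ∑ y, b y = c := Finset.sum_comm
  have ha0 : ∀ x, 0 ≤ a x := fun x => Finset.sum_nonneg fun y _ => hP u x y
  have hb0 : ∀ y, 0 ≤ b y := fun y => Finset.sum_nonneg fun x _ => hP u x y
  have hPa : ∀ x y, P u x y ≤ a x := fun x y =>
    Finset.single_le_sum (fun y _ => hP u x y) (Finset.mem_univ y)
  have hPb : ∀ x y, P u x y ≤ b y := fun x y =>
    Finset.single_le_sum (f := fun x => P u x y) (fun x _ => hP u x y) (Finset.mem_univ x)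
  have hac : ∀ x, a x ≤ c := fun x => Finset.single_le_sum (fun x _ => ha0 x) (Finset.mem_univ x)
  have hc0 : 0 ≤ c := Finset.sum_nonneg fun x _ => ha0 x
  have key : ∀ x y, (P u x y - a x * b y / c) / Real.log 2
      ≤ P u x y * Real.logb 2 ((P u x y * c) / (a x * b y)) := by
    intro x y
    rw [Real.logb, ← mul_div_assoc]
    refine div_le_div_of_nonneg_right ?_ (Real.log_nonneg one_le_two)
    have := mul_log_add_sub_le (hP u x y) (r := a x * b y / c) (g := 1)
      (div_nonneg (mul_nonneg (ha0 x) (hb0 y)) hc0) (fun h => ?_) one_pos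
    · simpa [div_div_eq_mul_div] using this
    · have hle := hPa x y
      have hle' := hPb x y
      have hle'' := hac x
      have h0 := hP u x y
      rcases div_eq_zero_iff.1 h with h | h
      · rcases mul_eq_zero.1 h with h | h <;> linarith
      · linarith
  refine le_trans ?_ (Finset.sum_le_sum fun x _ => Finset.sum_le_sum fun y _ => key x y)
  simp_rw [← Finset.sum_div, Finset.sum_sub_distrib, ← Finset.sum_div, ← Finset.mul_sum,
    ← Finset.sum_mul, hbc]
  rw [← hc, mul_self_div_self, sub_self, zero_div]

lemma sum_prod_mul_apply {S : Type*} [Fintype S] {n : ℕ} {V : Fin n → S → ℝ} (hV : IsCondDist V)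
    (i : Fin n) (f : S → ℝ) :
    ∑ s : Fin n → S, (∏ j, V j (s j)) * f (s i) = ∑ a, V i a * f a := by
  have h := sum_prod_eq_prod_sum (fun j a => V j a * if j = i then f a else 1)
  simp_rw [Finset.prod_mul_distrib, Finset.prod_ite_eq', Finset.mem_univ, if_true] at h
  rw [h, Finset.prod_eq_single i]
  · simp
  · intro j _ hj; simp [hj, (hV j).2]
  · simp

variable {ι X Y : Type*} [Fintype ι] [Fintype X] [Fintype Y]

/-- The law of the output letter `j` of a code over the channels `V j`. -/
def outputDist {n : ℕ} (φ : ι → Fin n → X) (V : Fin n → X → Y → ℝ) (j : Fin n) (y : Y) : ℝ :=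
  ∑ a, colDist φ j a * V j a y

/-- The sum over the letters of the mutual information, in nats, between input and output. -/
def sumMutualInfo {n : ℕ} (φ : ι → Fin n → X) (V : Fin n → X → Y → ℝ) : ℝ :=
  ∑ j, ∑ a, ∑ y, colDist φ j a * (V j a y * Real.log (V j a y / outputDist φ V j y))

lemma outputDist_mem_stdSimplex [Nonempty ι] {n : ℕ} (φ : ι → Fin n → X)
    {V : Fin n → X → Y → ℝ} (hV : ∀ j, IsCondDist (V j)) : IsCondDist (outputDist φ V) := by
  refine fun j => ⟨fun y => Finset.sum_nonneg fun a _ =>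
    mul_nonneg (colDist_nonneg φ j a) ((hV j a).1 y), ?_⟩
  unfold outputDist
  rw [Finset.sum_comm]
  simp_rw [← Finset.mul_sum, (hV j _).2, mul_one]
  exact (colDist_mem_stdSimplex φ j).2

/-- Fano's inequality for list decoding over a product channel. -/
lemma log_mul_correctProb_le [Nonempty ι] [DecidableEq ι] {n L : ℕ} (hL : 1 ≤ L)
    (φ : ι → Fin n → X)
    {V : Fin n → X → Y → ℝ} (hV : ∀ j, IsCondDist (V j)) {ψ : (Fin n → Y) → Finset ι}
    (hψ : ∀ y, (ψ y).card ≤ L) :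
    Real.log (Fintype.card ι / L) * ((Fintype.card ι : ℝ)⁻¹ *
      ∑ m, ∑ y, if m ∈ ψ y then ∏ j, V j (φ m j) (y j) else 0) ≤ sumMutualInfo φ V + 1 := by
  set M : ℝ := (Fintype.card ι : ℝ) with hM
  have hM0 : 0 < M := by rw [hM]; exact_mod_cast Fintype.card_pos
  have hL0 : (0 : ℝ) < L := by exact_mod_cast hL
  set r := outputDist φ V with hr
  have hrd : IsCondDist r := outputDist_mem_stdSimplex φ hV
  set K : ι → (Fin n → Y) → ℝ := fun m y => ∏ j, V j (φ m j) (y j) with hK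
  set Q : (Fin n → Y) → ℝ := fun y => ∏ j, r j (y j) with hQ
  have hVm : ∀ m, IsCondDist (fun j => V j (φ m j)) := fun m j => hV j _
  have hQs : Q ∈ stdSimplex ℝ _ := prodLaw_mem_stdSimplex hrd
  have hKs : ∀ m, K m ∈ stdSimplex ℝ _ := fun m => prodLaw_mem_stdSimplex (hVm m)
  have hVr : ∀ m j b, r j b = 0 → V j (φ m j) b = 0 := fun m j b h => by
    have h1 : r j b = M⁻¹ * ∑ m, V j (φ m j) b := sum_colDist_mul φ j (fun a => V j a b)
    rw [h, eq_comm, mul_eq_zero, or_iff_right (inv_pos.2 hM0).ne',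
      Finset.sum_eq_zero_iff_of_nonneg fun m _ => (hV j _).1 b] at h1
    exact h1 m (Finset.mem_univ m)
  -- The reference law `Q` is the product of the single-letter output laws, not the true output law
  -- of the code, so the divergence splits exactly over the letters.
  have hKL : ∑ m, ∑ y, K m y * Real.log (K m y / Q y) = M * sumMutualInfo φ V := by
    have h1 : ∀ m y, K m y * Real.log (K m y / Q y)
        = ∑ j, K m y * Real.log (V j (φ m j) (y j) / r j (y j)) := fun m y => by
      by_cases h : K m y = 0
      · simp [h]
      rw [← Finset.mul_sum, ← Real.log_prod, Finset.prod_div_distrib]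
      intro j _
      have : V j (φ m j) (y j) ≠ 0 := Finset.prod_ne_zero_iff.1 h j (Finset.mem_univ j)
      exact div_ne_zero this fun h0 => this (hVr m j _ h0)
    have h2 : ∀ m j, ∑ y, K m y * Real.log (V j (φ m j) (y j) / r j (y j))
        = ∑ b, V j (φ m j) b * Real.log (V j (φ m j) b / r j b) := fun m j =>
      sum_prod_mul_apply (hVm m) j (fun b => Real.log (V j (φ m j) b / r j b))
    simp_rw [h1]
    rw [Finset.sum_congr rfl fun m _ => Finset.sum_comm]
    simp_rw [h2]
    rw [Finset.sum_comm, sumMutualInfo, Finset.mul_sum]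
    refine Finset.sum_congr rfl fun j _ => ?_
    simp_rw [← Finset.mul_sum]
    rw [sum_colDist_mul φ j (fun a => ∑ b, V j a b * Real.log (V j a b / r j b)),
      mul_inv_cancel_left₀ hM0.ne']
  have hterm : ∀ m y, K m y * Real.log (if m ∈ ψ y then M / L else 1) + K m y
      - Q y * (if m ∈ ψ y then M / L else 1) ≤ K m y * Real.log (K m y / Q y) := fun m y => by
    refine mul_log_add_sub_le ((hKs m).1 y) (hQs.1 y) (fun h => ?_) (by split_ifs <;> positivity)
    obtain ⟨j, -, hj⟩ := Finset.prod_eq_zero_iff.1 h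
    exact Finset.prod_eq_zero (Finset.mem_univ j) (hVr m j _ hj)
  have hsum := Finset.sum_le_sum fun m (_ : m ∈ Finset.univ) =>
    Finset.sum_le_sum fun y (_ : y ∈ Finset.univ) => hterm m y
  rw [hKL] at hsum
  simp_rw [Finset.sum_sub_distrib, Finset.sum_add_distrib, (hKs _).2] at hsum
  -- Each list holds at most `L` messages of weight `M / L`, and the remaining ones have weight 1.
  -- This total of `2 * M` yields the `+ 1` in the conclusion.
  have hg : ∑ m, ∑ y, Q y * (if m ∈ ψ y then M / L else 1) ≤ 2 * M := by
    rw [Finset.sum_comm]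
    have : ∀ y, ∑ m, Q y * (if m ∈ ψ y then M / L else 1) ≤ Q y * (2 * M) := fun y => by
      rw [← Finset.mul_sum]
      refine mul_le_mul_of_nonneg_left ?_ (hQs.1 y)
      calc ∑ m, (if m ∈ ψ y then M / L else 1)
          ≤ ∑ m, ((if m ∈ ψ y then M / L else 0) + 1) := by
            refine Finset.sum_le_sum fun m _ => ?_
            split_ifs <;> linarith
        _ = (ψ y).card * (M / L) + M := by
            rw [Finset.sum_add_distrib, Finset.sum_ite_mem, Finset.univ_inter]
            simp [hM]
        _ ≤ L * (M / L) + M := by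
            gcongr
            exact_mod_cast hψ y
        _ = 2 * M := by field_simp; ring
    refine (Finset.sum_le_sum fun y _ => this y).trans ?_
    rw [← Finset.sum_mul, hQs.2, one_mul]
  have hlog : ∑ m, ∑ y, K m y * Real.log (if m ∈ ψ y then M / L else 1)
      = Real.log (M / L) * ∑ m, ∑ y, if m ∈ ψ y then K m y else 0 := by
    simp_rw [Finset.mul_sum]
    refine Finset.sum_congr rfl fun m _ => Finset.sum_congr rfl fun y _ => ?_
    split_ifs <;> simp [mul_comm]
  rw [hlog] at hsum
  simp only [Finset.sum_const, Finset.card_univ, nsmul_eq_mul, mul_one] at hsum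
  rw [← hM] at hsum
  refine le_of_mul_le_mul_left ?_ hM0
  calc _ = Real.log (M / L) * ∑ m, ∑ y, (if m ∈ ψ y then K m y else 0) := by
        rw [mul_left_comm, mul_inv_cancel_left₀ hM0.ne']
    _ ≤ _ := by linarith

end Information

/-! ### Memoryless jamming with independent state letters. -/

namespace ObliviousAVC

variable {ι X S Y : Type*} [Fintype ι] [Fintype X] [Fintype S] [Fintype Y]
  (A : ObliviousAVC X S Y)

/-- The channel seen by the code if the state letter `j` has the law `U j`. -/
def jammedChannel {n : ℕ} (U : Fin n → S → ℝ) (j : Fin n) (x : X) (y : Y) : ℝ :=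
  ∑ s, U j s * A.W x s y

lemma jammedChannel_mem {n : ℕ} {U : Fin n → S → ℝ} (hU : IsCondDist U) (j : Fin n) :
    IsCondDist (A.jammedChannel U j) := by
  refine fun x => ⟨fun y => Finset.sum_nonneg fun s _ =>
    mul_nonneg ((hU j).1 s) ((A.W_mem x s).1 y), ?_⟩
  unfold jammedChannel
  rw [Finset.sum_comm]
  simp_rw [← Finset.mul_sum, (A.W_mem _ _).2, mul_one]
  exact (hU j).2

/-- With uniform time sharing over the letters, the conditional mutual information is the average of
the mutual informations of the letters. -/
lemma sumMutualInfo_jammedChannel {n : ℕ} (hn : 1 ≤ n) [Nonempty ι] (φ : ι → Fin n → X)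
    {U : Fin n → S → ℝ} (hU : IsCondDist U) :
    sumMutualInfo φ (A.jammedChannel U) = n * Real.log 2 *
      condMutualInfo (A.jointLaw (fun _ => (n : ℝ)⁻¹) (colDist φ) U) := by
  have hn0 : (n : ℝ) ≠ 0 := by exact_mod_cast (by omega : n ≠ 0)
  have hlog : Real.log 2 ≠ 0 := (Real.log_pos one_lt_two).ne'
  have hJ : ∀ j x y, A.jointLaw (fun _ => (n : ℝ)⁻¹) (colDist φ) U j x y
      = (n : ℝ)⁻¹ * (colDist φ j x * A.jammedChannel U j x y) := fun j x y => by
    rw [jointLaw, jammedChannel, ← mul_assoc, Finset.mul_sum]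
    exact Finset.sum_congr rfl fun s _ => by ring
  unfold sumMutualInfo condMutualInfo
  simp_rw [hJ, ← Finset.mul_sum, (A.jammedChannel_mem hU _ _).2, mul_one,
    (colDist_mem_stdSimplex φ _).2]
  rw [Finset.mul_sum]
  refine Finset.sum_congr rfl fun j _ => ?_
  rw [Finset.mul_sum]
  refine Finset.sum_congr rfl fun x _ => ?_
  rw [Finset.mul_sum, Finset.mul_sum]
  refine Finset.sum_congr rfl fun y _ => ?_
  by_cases hp : colDist φ j x = 0
  · simp [hp]
  have : (n : ℝ)⁻¹ * (colDist φ j x * A.jammedChannel U j x y) * ((n : ℝ)⁻¹ * 1) /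
      ((n : ℝ)⁻¹ * colDist φ j x * ((n : ℝ)⁻¹ * ∑ a, colDist φ j a * A.jammedChannel U j a y))
      = A.jammedChannel U j x y / outputDist φ (A.jammedChannel U) j y := by
    rw [outputDist]
    -- For an output letter of probability zero both quotients are divisions by zero, hence equal to
    -- 0.
    by_cases h0 : ∑ a, colDist φ j a * A.jammedChannel U j a y = 0
    · simp [h0]
    · field_simp
  rw [this, Real.logb]
  field_simp

/-- The list-decoding error probability, averaged over the messages of a code with an arbitrary
finite message set, for the state sequence `s`. -/
def meanError [DecidableEq ι] {n : ℕ} (φ : ι → Fin n → X) (ψ : (Fin n → Y) → Finset ι)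
    (s : Fin n → S) : ℝ :=
  (Fintype.card ι : ℝ)⁻¹ * ∑ m, ∑ y, if m ∈ ψ y then 0 else ∏ j, A.W (φ m j) (s j) (y j)

lemma sum_prod_mul_prod_W {n : ℕ} (U : Fin n → S → ℝ) (x : Fin n → X) (y : Fin n → Y) :
    ∑ s : Fin n → S, (∏ j, U j (s j)) * ∏ j, A.W (x j) (s j) (y j)
      = ∏ j, A.jammedChannel U j (x j) (y j) := by
  simp_rw [← Finset.prod_mul_distrib]
  exact sum_prod_eq_prod_sum (fun j s => U j s * A.W (x j) s (y j))

lemma sum_prod_mul_meanError [DecidableEq ι] {n : ℕ} (U : Fin n → S → ℝ) (φ : ι → Fin n → X)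
    (ψ : (Fin n → Y) → Finset ι) :
    ∑ s : Fin n → S, (∏ j, U j (s j)) * A.meanError φ ψ s
      = (Fintype.card ι : ℝ)⁻¹ * ∑ m, ∑ y,
        if m ∈ ψ y then 0 else ∏ j, A.jammedChannel U j (φ m j) (y j) := by
  unfold meanError
  simp_rw [mul_left_comm _ (Fintype.card ι : ℝ)⁻¹, Finset.mul_sum]
  rw [Finset.sum_comm]
  refine Finset.sum_congr rfl fun m _ => ?_
  rw [Finset.sum_comm]
  refine Finset.sum_congr rfl fun y _ => ?_
  split_ifs
  · simp
  · rw [← Finset.mul_sum, A.sum_prod_mul_prod_W U (φ m) y]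

/-- Memoryless jamming below the rate of the code. -/
lemma one_sub_le_sum_prod_mul_meanError [Nonempty ι] [DecidableEq ι] {n L : ℕ} (hL : 1 ≤ L)
    {φ : ι → Fin n → X} {U : Fin n → S → ℝ} (hU : IsCondDist U) {ψ : (Fin n → Y) → Finset ι}
    (hψ : ∀ y, (ψ y).card ≤ L) (hlog : 0 < Real.log (Fintype.card ι / L)) :
    1 - (sumMutualInfo φ (A.jammedChannel U) + 1) / Real.log (Fintype.card ι / L)
      ≤ ∑ s : Fin n → S, (∏ j, U j (s j)) * A.meanError φ ψ s := by
  have hV := A.jammedChannel_mem hU (X := X)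
  have h := log_mul_correctProb_le hL φ hV hψ
  have hM0 : (Fintype.card ι : ℝ) ≠ 0 := by exact_mod_cast Fintype.card_ne_zero
  have htot : (Fintype.card ι : ℝ)⁻¹ *
      ∑ m, ∑ y : Fin n → Y, ∏ j, A.jammedChannel U j (φ m j) (y j) = 1 := by
    have : ∀ m, ∑ y : Fin n → Y, ∏ j, A.jammedChannel U j (φ m j) (y j) = 1 := fun m =>
      (prodLaw_mem_stdSimplex (V := fun j => A.jammedChannel U j (φ m j)) fun j => hV j _).2
    simp [this, hM0]
  rw [sum_prod_mul_meanError]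
  have hsplit : ∀ m (y : Fin n → Y), (if m ∈ ψ y then 0 else
      ∏ j, A.jammedChannel U j (φ m j) (y j)) = ∏ j, A.jammedChannel U j (φ m j) (y j)
        - if m ∈ ψ y then ∏ j, A.jammedChannel U j (φ m j) (y j) else 0 := fun m y => by
    split_ifs <;> simp
  simp_rw [hsplit, Finset.sum_sub_distrib]
  rw [mul_sub, htot]
  refine sub_le_sub_left ?_ 1
  rw [le_div_iff₀ hlog]
  linarith

end ObliviousAVC

/-! ### Jamming with a random list of codewords. -/

lemma half_pow_le_card_injective {ι : Type*} [Fintype ι] [DecidableEq ι] {L : ℕ}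
    (h : 2 * L * (L + 1) ≤ Fintype.card ι) (h0 : 0 < Fintype.card ι) :
    (Fintype.card ι : ℝ) ^ (L + 1) / 2 ≤
      ((Finset.univ.filter fun N : Fin (L + 1) → ι => Function.Injective N).card : ℝ) := by
  set M := Fintype.card ι with hM
  have hLM : L ≤ M := by nlinarith
  have h1 : (Finset.univ.filter fun N : Fin (L + 1) → ι => Function.Injective N).card
      = M.descFactorial (L + 1) := by
    rw [← Fintype.card_subtype, Fintype.card_congr (Equiv.subtypeInjectiveEquivEmbedding _ _),
      Fintype.card_embedding_eq, Fintype.card_fin]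
  have h2 := Nat.pow_sub_le_descFactorial M (L + 1)
  have h3 : (M - L : ℝ) ^ (L + 1) ≤ M.descFactorial (L + 1) := by
    have : ((M + 1 - (L + 1) : ℕ) : ℝ) = M - L := by
      rw [Nat.add_sub_add_right, Nat.cast_sub hLM]
    rw [← this]
    exact_mod_cast h2
  have hM0 : (0 : ℝ) < M := by exact_mod_cast h0
  have hh : (2 * L * (L + 1) : ℝ) ≤ M := by exact_mod_cast h
  have hLM' : (L : ℝ) ≤ M := by exact_mod_cast hLM
  have hdiv : (L : ℝ) / M ≤ 1 := div_le_one_of_le₀ hLM' hM0.le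
  -- Bernoulli's inequality: the probability of a repetition is at most L(L+1)/M, which is at most
  -- 1/2.
  have h4 := one_add_mul_le_pow (show (-2 : ℝ) ≤ -(L / M) by linarith) (L + 1)
  have h5 : ((L + 1 : ℕ) : ℝ) * (L / M) ≤ 1 / 2 := by
    push_cast
    rw [← mul_div_assoc, div_le_iff₀ hM0]
    linarith
  have h6 : (M - L : ℝ) ^ (L + 1) = M ^ (L + 1) * (1 + -(L / M)) ^ (L + 1) := by
    rw [← mul_pow]
    congr 1
    field_simp
    ring
  rw [h1]
  refine le_trans ?_ h3
  rw [h6, div_eq_mul_one_div]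
  refine mul_le_mul_of_nonneg_left (le_trans ?_ h4) (by positivity)
  linarith

namespace ObliviousAVC

variable {ι X S Y : Type*} [Fintype ι] [Fintype X] [Fintype S] [Fintype Y]
  (A : ObliviousAVC X S Y)

/-- The laws of the state letters induced by a channel `U` fed with a list of codewords. -/
def listLaw {n L : ℕ} (U : Fin n → (Fin L → X) → S → ℝ) (φ : ι → Fin n → X) (m : Fin L → ι)
    (j : Fin n) : S → ℝ :=
  U j fun l => φ (m l) j

/-- Jamming with a random list of codewords through a symmetrizing channel. -/
lemma le_sum_listLaw_meanError [DecidableEq ι] [Nonempty ι] {n L : ℕ}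
    {U : Fin n → (Fin L → X) → S → ℝ} (hU : A.IsSymmetrizing L U) (φ : ι → Fin n → X)
    {ψ : (Fin n → Y) → Finset ι} (hψ : ∀ y, (ψ y).card ≤ L)
    (hcard : 2 * L * (L + 1) ≤ Fintype.card ι) :
    (Fintype.card ι : ℝ) ^ L * (1 / (2 * (L + 1))) ≤
      ∑ m : Fin L → ι, ∑ s : Fin n → S, (∏ j, listLaw U φ m j (s j)) * A.meanError φ ψ s := by
  set M : ℝ := (Fintype.card ι : ℝ) with hM
  have hM0 : 0 < M := by rw [hM]; exact_mod_cast Fintype.card_pos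
  -- `N 0` is the transmitted message and the other entries are the jammer's list. Symmetrization
  -- makes the output law blind to which entry was sent.
  set Z : (Fin (L + 1) → ι) → (Fin n → Y) → ℝ := fun N y =>
    ∏ j, A.jammedChannel (listLaw U φ fun l => N l.succ) j (φ (N 0) j) (y j) with hZ
  have hZs : ∀ N, Z N ∈ stdSimplex ℝ (Fin n → Y) := fun N =>
    prodLaw_mem_stdSimplex fun j => A.jammedChannel_mem (fun j => hU.1 _ _) j _
  have hZperm : ∀ (N : Fin (L + 1) → ι) (π : Equiv.Perm (Fin (L + 1))) (y : Fin n → Y),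
      Z (N ∘ π) y = Z N y := fun N π y => by
    refine Finset.prod_congr rfl fun j _ => ?_
    have := hU.2 j (fun i => φ (N i) j) (y j) π
    simp only [jammedChannel, listLaw, Function.comp]
    simp_rw [mul_comm (U _ _ _)]
    exact this.symm
  set F : ℝ := ∑ N : Fin (L + 1) → ι, ∑ y, if N 0 ∈ ψ y then 0 else Z N y with hF
  have hmain : ∑ m : Fin L → ι, ∑ s : Fin n → S, (∏ j, listLaw U φ m j (s j)) *
      A.meanError φ ψ s = M⁻¹ * F := by
    rw [hF, sum_fin_succ_fun, Finset.mul_sum]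
    refine Finset.sum_congr rfl fun m _ => ?_
    rw [sum_prod_mul_meanError]
    simp only [hZ, Fin.cons_zero, Fin.cons_succ]
    rfl
  have hFi : ∀ i : Fin (L + 1), ∑ N : Fin (L + 1) → ι, ∑ y, (if N i ∈ ψ y then 0 else Z N y)
      = F := fun i => by
    rw [hF, ← ((Equiv.swap 0 i).arrowCongr (Equiv.refl ι)).sum_comp]
    refine Finset.sum_congr rfl fun N _ => Finset.sum_congr rfl fun y _ => ?_
    have h1 : ((Equiv.swap 0 i).arrowCongr (Equiv.refl ι)) N = N ∘ (Equiv.swap 0 i) := by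
      funext a
      simp [Equiv.arrowCongr]
    rw [h1, hZperm, Function.comp, Equiv.swap_apply_right]
  have hLF : (L + 1 : ℝ) * F = ∑ N : Fin (L + 1) → ι, ∑ y, ∑ i : Fin (L + 1),
      if N i ∈ ψ y then 0 else Z N y := by
    have : ∑ i : Fin (L + 1), F = (L + 1 : ℝ) * F := by simp
    rw [← this, ← Finset.sum_congr rfl fun i _ => hFi i, Finset.sum_comm]
    exact Finset.sum_congr rfl fun N _ => Finset.sum_comm
  have hnn : ∀ N y i, 0 ≤ (if N i ∈ ψ y then 0 else Z N y) := fun N y i => by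
    split_ifs
    exacts [le_rfl, (hZs N).1 y]
  -- By symmetry `F` can be computed with any `N i` as the sent message. Adding over `i`, every
  -- tuple of distinct messages contributes at least 1, because a list of size `L` misses one of `L
  -- + 1` messages.
  have hge : ((Finset.univ.filter fun N : Fin (L + 1) → ι => Function.Injective N).card : ℝ)
      ≤ (L + 1 : ℝ) * F := by
    rw [hLF, Finset.card_eq_sum_ones, Nat.cast_sum]
    refine le_trans (Finset.sum_le_sum fun N hN => ?_) (Finset.sum_le_univ_sum_of_nonneg fun N =>
      Finset.sum_nonneg fun y _ => Finset.sum_nonneg fun i _ => hnn N y i)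
    rw [Nat.cast_one, ← (hZs N).2]
    refine Finset.sum_le_sum fun y _ => ?_
    obtain ⟨i, hi⟩ : ∃ i, N i ∉ ψ y := by
      by_contra! hall
      have h1 : (Finset.univ.image N).card ≤ (ψ y).card :=
        Finset.card_le_card fun a ha => by
          obtain ⟨i, -, rfl⟩ := Finset.mem_image.1 ha
          exact hall i
      rw [Finset.card_image_of_injective _ (Finset.mem_filter.1 hN).2, Finset.card_univ,
        Fintype.card_fin] at h1
      have := hψ y
      omega
    refine le_trans (le_of_eq ?_) (Finset.single_le_sum (fun i _ => hnn N y i) (Finset.mem_univ i))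
    simp [hi]
  have hinj := (half_pow_le_card_injective hcard Fintype.card_pos).trans hge
  rw [hmain]
  rw [← hM, pow_succ] at hinj
  have hL : (0 : ℝ) < L + 1 := by positivity
  rw [inv_mul_eq_div, le_div_iff₀ hM0]
  refine le_of_mul_le_mul_left (le_trans (le_of_eq ?_) hinj) hL
  field_simp

/-- For a concentrated code, the state sequence obtained from a random list of codewords has the
expected type. -/
lemma sum_listLaw_mul_l1Dist_le [Nonempty ι] {n L : ℕ} (hn : 1 ≤ n) {ε : ℝ}
    {φ : ι → Fin n → X} (hφ : Concentrated ε φ) {U : Fin n → (Fin L → X) → S → ℝ}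
    (hU : ∀ j, IsCondDist (U j)) :
    ∑ m : Fin L → ι, ∑ s : Fin n → S, (∏ j, listLaw U φ m j (s j)) * l1Dist (typeOf s)
      (fun s => ∑ j, ∑ x : Fin L → X, (n : ℝ)⁻¹ * (∏ l, colDist φ j (x l)) * U j x s) ≤
      (Fintype.card ι : ℝ) ^ L * (Fintype.card S / √n + Fintype.card S * (L * ε)) := by
  have hn0 : (0 : ℝ) < n := by exact_mod_cast hn
  set Q : S → ℝ := fun s => ∑ j, ∑ x : Fin L → X, (n : ℝ)⁻¹ * (∏ l, colDist φ j (x l)) * U j x s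
    with hQ
  set V : (Fin L → ι) → S → ℝ := fun m s => (n : ℝ)⁻¹ * ∑ j, listLaw U φ m j s with hV
  have hlaw : ∀ m, IsCondDist (listLaw U φ m) := fun m j => hU _ _
  have h1 : ∀ a, ∑ m, |V m a - Q a| ≤ (Fintype.card ι : ℝ) ^ L * (L * ε) := fun a => by
    have h := hφ.sum_abs_le L (fun j x => U j x a) fun j x => by
      rw [abs_of_nonneg ((hU j x).1 a), ← (hU j x).2]
      exact Finset.single_le_sum (fun b _ => (hU j x).1 b) (Finset.mem_univ a)
    have h2 : ∀ m, |V m a - Q a| = (n : ℝ)⁻¹ * |∑ j, (U j (fun l => φ (m l) j) a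
        - ∑ x : Fin L → X, (∏ l, colDist φ j (x l)) * U j x a)| := fun m => by
      rw [← abs_of_pos (inv_pos.2 hn0), ← abs_mul, Finset.sum_sub_distrib, mul_sub]
      congr 2
      simp only [hQ, Finset.mul_sum, mul_assoc]
    simp_rw [h2]
    rw [← Finset.mul_sum, inv_mul_le_iff₀ hn0]
    linarith
  -- Two fluctuations: the independent letters given the list, and the average letter law as the
  -- list varies. Concentration controls the second.
  calc _ ≤ ∑ m : Fin L → ι, (Fintype.card S / √n + l1Dist (V m) Q) := by
        refine Finset.sum_le_sum fun m _ => ?_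
        have hs := prodLaw_mem_stdSimplex (hlaw m)
        calc _ ≤ ∑ s : Fin n → S, ((∏ j, listLaw U φ m j (s j)) * l1Dist (typeOf s) (V m)
              + (∏ j, listLaw U φ m j (s j)) * l1Dist (V m) Q) := by
              refine Finset.sum_le_sum fun s _ => ?_
              rw [← mul_add]
              exact mul_le_mul_of_nonneg_left (l1Dist_triangle _ _ _) (hs.1 s)
          _ ≤ _ := by
              rw [Finset.sum_add_distrib, ← Finset.sum_mul, hs.2, one_mul]
              exact add_le_add_left (sum_prod_mul_l1Dist_le hn (hlaw m)) _
    _ ≤ _ := by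
        rw [Finset.sum_add_distrib, Finset.sum_const, Finset.card_univ, Fintype.card_fun,
          Fintype.card_fin, nsmul_eq_mul, mul_add]
        push_cast
        refine add_le_add_right ?_ _
        unfold l1Dist
        rw [Finset.sum_comm]
        refine (Finset.sum_le_sum fun a _ => h1 a).trans (le_of_eq ?_)
        rw [Finset.sum_const, Finset.card_univ, nsmul_eq_mul]
        ring

end ObliviousAVC

/-! ### The coordinate as time-sharing variable, and the two jamming cases. -/

lemma mixPower_mem_selfCouplings {X : Type*} [Fintype X] (L : ℕ) {k : ℕ} {Pu : Fin k → ℝ}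
    {Pxu : Fin k → X → ℝ} (hu : Pu ∈ stdSimplex ℝ (Fin k)) (hx : IsCondDist Pxu) :
    mixPower L Pu Pxu ∈ selfCouplings L (fun a => ∑ u, Pu u * Pxu u a) := by
  classical
  have hpow : ∀ u, (fun x : Fin L → X => ∏ l, Pxu u (x l)) ∈ stdSimplex ℝ (Fin L → X) :=
    fun u => prodLaw_mem_stdSimplex (fun _ => hx u)
  refine ⟨⟨fun x => Finset.sum_nonneg fun u _ => mul_nonneg (hu.1 u) ((hpow u).1 x), ?_⟩,
    fun l => ?_⟩
  · unfold mixPower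
    rw [Finset.sum_comm]
    simp_rw [← Finset.mul_sum, (hpow _).2, mul_one]
    exact hu.2
  · funext a
    unfold coordMarginal mixPower
    rw [Finset.sum_comm]
    refine Finset.sum_congr rfl fun u _ => ?_
    rw [← Finset.mul_sum, Finset.sum_filter]
    have := sum_prod_mul_apply (V := fun _ : Fin L => Pxu u) (fun _ => hx u) l
      (fun b => if b = a then 1 else 0)
    simp only [mul_ite, mul_one, mul_zero, Finset.sum_ite_eq', Finset.mem_univ, if_true] at this
    rw [← this]

/-- Double counting over rows and columns. It exhibits the input marginal as a convex combination of
codeword types, so that it inherits the input constraints. -/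
lemma sum_inv_mul_colDist {ι X : Type*} [Fintype ι] [Fintype X] {n : ℕ} (φ : ι → Fin n → X) :
    (fun a => ∑ j, (n : ℝ)⁻¹ * colDist φ j a)
      = ∑ m, (Fintype.card ι : ℝ)⁻¹ • typeOf (φ m) := by
  classical
  funext a
  have h : ∀ j, colDist φ j a
      = (Fintype.card ι : ℝ)⁻¹ * ∑ m, if φ m j = a then (1 : ℝ) else 0 := fun j => by
    rw [← sum_colDist_mul φ j (fun b => if b = a then 1 else 0)]
    simp
  simp_rw [Finset.sum_apply, Pi.smul_apply, typeOf_eq_sum, h, smul_eq_mul, Finset.mul_sum]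
  rw [Finset.sum_comm]
  exact Finset.sum_congr rfl fun m _ => Finset.sum_congr rfl fun j _ => mul_left_comm _ _ _

namespace ObliviousAVC

section

variable {ι X S Y : Type*} [Fintype ι] [Fintype X] [Fintype S] [Fintype Y]
  (A : ObliviousAVC X S Y)

/-- A concentrated code has a law of the state sequence, of nearly admissible type on average, that
causes a large error for every list decoder. -/
lemma exists_stateLaw [Nonempty ι] [DecidableEq ι] {n L : ℕ} (hn : 1 ≤ n) (hL : 1 ≤ L) {ε : ℝ}
    (hε : 0 ≤ ε) {φ : ι → Fin n → X} (hφ : Concentrated ε φ)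
    (hfeas : ∀ m, typeOf (φ m) ∈ A.inputConstr) {C : ℝ} (hC : A.capacityExpr L < C)
    (hcard : 2 * L * (L + 1) ≤ Fintype.card ι) (hlog : 0 < Real.log (Fintype.card ι / L)) :
    ∃ q ∈ stdSimplex ℝ (Fin n → S), ∃ Q ∈ A.stateConstr,
      ∑ s, q s * l1Dist (typeOf s) Q
        ≤ Fintype.card S / √n + Fintype.card S * (L * ε) ∧
      ∀ ψ : (Fin n → Y) → Finset ι, (∀ y, (ψ y).card ≤ L) →
        min (1 - (n * Real.log 2 * C + 1) / Real.log (Fintype.card ι / L)) (1 / (2 * (L + 1)))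
          ≤ ∑ s, q s * A.meanError φ ψ s := by
  have hn0 : (0 : ℝ) < n := by exact_mod_cast hn
  have hM0 : (0 : ℝ) < Fintype.card ι := by exact_mod_cast Fintype.card_pos
  have hu : (fun _ : Fin n => (n : ℝ)⁻¹) ∈ stdSimplex ℝ (Fin n) :=
    ⟨fun _ => (inv_pos.2 hn0).le, by simp [hn0.ne']⟩
  have hx : IsCondDist (colDist φ) := colDist_mem_stdSimplex φ
  -- A symmetrizable pair invites list jamming; otherwise the pair competes in the supremum of
  -- `capacityExpr`.
  by_cases hsym : A.PairSymmetrizable L (fun _ : Fin n => (n : ℝ)⁻¹) (colDist φ)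
  · obtain ⟨U, hU, hQ⟩ := hsym
    have hlaw : ∀ m, IsCondDist (listLaw U φ m) := fun m j => hU.1 _ _
    have hpow : (0 : ℝ) < (Fintype.card ι : ℝ) ^ L := by positivity
    have hswap : ∀ f : (Fin n → S) → ℝ, ∑ s : Fin n → S, (((Fintype.card ι : ℝ) ^ L)⁻¹ *
        ∑ m : Fin L → ι, ∏ j, listLaw U φ m j (s j)) * f s = ((Fintype.card ι : ℝ) ^ L)⁻¹ *
        ∑ m : Fin L → ι, ∑ s : Fin n → S, (∏ j, listLaw U φ m j (s j)) * f s := fun f => by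
      simp_rw [mul_assoc, ← Finset.mul_sum, Finset.sum_mul]
      rw [Finset.sum_comm]
    refine ⟨fun s => ((Fintype.card ι : ℝ) ^ L)⁻¹ * ∑ m : Fin L → ι,
      ∏ j, listLaw U φ m j (s j), ⟨fun s => ?_, ?_⟩, _, hQ, ?_, fun ψ hψ => ?_⟩
    · exact mul_nonneg (inv_pos.2 hpow).le
        (Finset.sum_nonneg fun m _ => (prodLaw_mem_stdSimplex (hlaw m)).1 s)
    · have := hswap fun _ => 1
      simp only [mul_one] at this
      rw [this]
      simp_rw [(prodLaw_mem_stdSimplex (hlaw _)).2]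
      simp [hM0.ne']
    · rw [hswap, inv_mul_le_iff₀ hpow]
      exact sum_listLaw_mul_l1Dist_le hn hφ hU.1
    · rw [hswap, le_inv_mul_iff₀ hpow]
      exact (mul_le_mul_of_nonneg_left (min_le_right _ _) hpow.le).trans
        (A.le_sum_listLaw_meanError hU φ hψ hcard)
  · have hPx : (fun a => ∑ j, (n : ℝ)⁻¹ * colDist φ j a) ∈ A.inputConstr := by
      rw [sum_inv_mul_colDist]
      exact A.inputConstr_convex.sum_mem (fun _ _ => (inv_pos.2 hM0).le) (by simp [hM0.ne'])
        fun m _ => hfeas m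
    have hdec : IsCPDecomp (mixPower L (fun _ : Fin n => (n : ℝ)⁻¹) (colDist φ))
      (fun _ : Fin n => (n : ℝ)⁻¹) (colDist φ) := ⟨hu, hx, rfl⟩
    have hcp : mixPower L (fun _ : Fin n => (n : ℝ)⁻¹) (colDist φ) ∈
        cpSet L (fun a => ∑ j, (n : ℝ)⁻¹ * colDist φ j a) :=
      ⟨mixPower_mem_selfCouplings L hu hx, n, _, _, hdec⟩
    have hle : (⨅ (U : Fin n → S → ℝ) (_ : IsCondDist U)
        (_ : (fun s => ∑ u, (n : ℝ)⁻¹ * U u s) ∈ A.stateConstr),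
        ((condMutualInfo (A.jointLaw (fun _ => (n : ℝ)⁻¹) (colDist φ) U) : ℝ) : EReal))
          ≤ A.capacityExpr L :=
      le_iSup₂_of_le _ hPx <| le_iSup₂_of_le _ hcp <| le_iSup₂_of_le n _ <|
        le_iSup_of_le _ <| le_iSup₂_of_le hdec hsym le_rfl
    have hlt := hle.trans_lt hC
    obtain ⟨U, hlt⟩ := iInf_lt_iff.1 hlt
    obtain ⟨hU, hlt⟩ := iInf_lt_iff.1 hlt
    obtain ⟨hQ, hlt⟩ := iInf_lt_iff.1 hlt
    rw [EReal.coe_lt_coe_iff] at hlt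
    have hQ' : (fun s => (n : ℝ)⁻¹ * ∑ j, U j s) ∈ A.stateConstr := by
      simpa only [Finset.mul_sum] using hQ
    refine ⟨_, prodLaw_mem_stdSimplex hU, _, hQ', ?_, fun ψ hψ => ?_⟩
    · refine (sum_prod_mul_l1Dist_le hn hU).trans (le_add_of_nonneg_right ?_)
      positivity
    · refine (min_le_left _ _).trans (le_trans ?_
        (A.one_sub_le_sum_prod_mul_meanError hL (φ := φ) hU hψ hlog))
      rw [A.sumMutualInfo_jammedChannel hn φ hU]
      refine sub_le_sub_left (div_le_div_of_nonneg_right ?_ hlog.le) 1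
      have : 0 < n * Real.log 2 := mul_pos hn0 (Real.log_pos one_lt_two)
      have := mul_le_mul_of_nonneg_left hlt.le this.le
      linarith

/-! ### From the subcode to the full code, and the choice of constants. -/

lemma meanError_mem_Icc [DecidableEq ι] {n : ℕ} (φ : ι → Fin n → X)
    (ψ : (Fin n → Y) → Finset ι) (s : Fin n → S) : A.meanError φ ψ s ∈ Set.Icc (0 : ℝ) 1 := by
  have hK : ∀ m, (fun y : Fin n → Y => ∏ j, A.W (φ m j) (s j) (y j)) ∈ stdSimplex ℝ _ :=
    fun m => prodLaw_mem_stdSimplex fun j => A.W_mem _ _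
  have h0 : ∀ m y, 0 ≤ (if m ∈ ψ y then 0 else ∏ j, A.W (φ m j) (s j) (y j)) := fun m y => by
    split_ifs
    exacts [le_rfl, (hK m).1 y]
  refine ⟨mul_nonneg (by positivity)
    (Finset.sum_nonneg fun m _ => Finset.sum_nonneg fun y _ => h0 m y), ?_⟩
  rw [meanError, inv_mul_eq_div]
  refine div_le_one_of_le₀ ?_ (Nat.cast_nonneg _)
  calc _ ≤ ∑ _m : ι, (1 : ℝ) := Finset.sum_le_sum fun m _ => by
        rw [← (hK m).2]
        exact Finset.sum_le_sum fun y _ => by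
          split_ifs
          exacts [(hK m).1 y, le_rfl]
    _ = _ := by simp

/-- The error probability of a code in terms of that of a subcode. -/
lemma mul_meanError_le_errorProb {n M : ℕ} (φ : Fin M → Fin n → X)
    (ψ : (Fin n → Y) → Finset (Fin M)) (s : Fin n → S) (B : Finset (Fin M)) (hB : B.Nonempty) :
    (B.card / M : ℝ) * A.meanError (fun m : B => φ m) (fun y => (ψ y).subtype (· ∈ B)) s
      ≤ A.errorProb φ ψ s := by
  classical
  have hB0 : (B.card : ℝ) ≠ 0 := by exact_mod_cast hB.card_ne_zero
  set e : Fin M → ℝ := fun m => ∑ y, if m ∈ ψ y then 0 else ∏ j, A.W (φ m j) (s j) (y j) with he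
  have h1 : A.errorProb φ ψ s = (1 / (M : ℝ)) * ∑ m, e m := by
    unfold errorProb
    congr 1
    refine Finset.sum_congr rfl fun m _ => ?_
    rw [Finset.sum_filter, he]
    refine Finset.sum_congr rfl fun y _ => ?_
    by_cases h : m ∈ ψ y <;> simp [h]
  have h2 : A.meanError (fun m : B => φ m) (fun y => (ψ y).subtype (· ∈ B)) s
      = (B.card : ℝ)⁻¹ * ∑ m ∈ B, e m := by
    rw [meanError, Fintype.card_coe, ← Finset.sum_coe_sort B]
    congr 1
    refine Finset.sum_congr rfl fun m _ => Finset.sum_congr rfl fun y _ => ?_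
    simp only [Finset.mem_subtype]
  rw [h1, h2]
  have h3 : ∑ m ∈ B, e m ≤ ∑ m, e m := Finset.sum_le_univ_sum_of_nonneg fun m =>
    Finset.sum_nonneg fun y _ => by
      split_ifs
      exacts [le_rfl, Finset.prod_nonneg fun j _ => (A.W_mem _ _).1 _]
  calc _ = (1 / (M : ℝ)) * ∑ m ∈ B, e m := by field_simp
    _ ≤ _ := mul_le_mul_of_nonneg_left h3 (by positivity)

lemma sum_mul_errorProb_le_avgErrorProb {n M : ℕ} {κ : ℝ} {q : (Fin n → S) → ℝ}
    (hq : A.IsJammingStrategy κ q) (φ : Fin M → Fin n → X) (ψ : (Fin n → Y) → Finset (Fin M)) :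
    ∑ s, q s * A.errorProb φ ψ s ≤ A.avgErrorProb κ φ ψ := by
  rw [← one_mul (A.avgErrorProb κ φ ψ), ← hq.1.2, Finset.sum_mul]
  refine Finset.sum_le_sum fun s _ => ?_
  by_cases hs : q s = 0
  · simp [hs]
  · exact mul_le_mul_of_nonneg_left (le_ciSup (f := fun s : {s : Fin n → S // A.StateFeasible κ s} =>
      A.errorProb φ ψ s.1) (Set.finite_range _).bddAbove ⟨s, hq.2 s hs⟩) (hq.1.1 s)

/-- `hLcp` supplies a feasible input with a non-symmetrizable decomposition, so the supremum is not
the empty one, `⊥`. Every competitor is an infimum of nonnegative mutual informations. -/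
lemma capacityExpr_nonneg {L : ℕ} (hL : 1 ≤ L) (hLcp : A.cpSymmetrizability < (L : ℕ∞)) :
    0 ≤ A.capacityExpr L := by
  obtain ⟨Px, h⟩ := iInf_lt_iff.1 hLcp
  obtain ⟨hPx, h⟩ := iInf_lt_iff.1 h
  have hns : ¬ A.InputSymmetrizable L Px := fun hs =>
    h.not_ge (le_iSup₂_of_le (f := fun (L : ℕ) (_ : L ∈ {L : ℕ | 1 ≤ L ∧ A.InputSymmetrizable L Px})
      => (L : ℕ∞)) L ⟨hL, hs⟩ le_rfl)
  unfold InputSymmetrizable at hns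
  push Not at hns
  obtain ⟨P, hP, k, Pu, Pxu, hdec, hsym⟩ := hns
  refine le_iSup₂_of_le Px hPx <| le_iSup₂_of_le P hP <| le_iSup₂_of_le k Pu <|
    le_iSup_of_le Pxu <| le_iSup₂_of_le hdec hsym ?_
  refine le_iInf fun U => le_iInf fun hU => le_iInf fun _ => ?_
  rw [EReal.coe_nonneg]
  exact condMutualInfo_nonneg fun u x y => Finset.sum_nonneg fun s _ =>
    mul_nonneg (mul_nonneg (mul_nonneg (hdec.1.1 u) ((hdec.2.1 u).1 x)) ((hU u).1 s))
      ((A.W_mem x s).1 y)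

/-- The jamming strategies of the converse, for a finite value of the capacity expression. -/
lemma exists_jamming {L : ℕ} (hL : 1 ≤ L) {C : ℝ} (hC : A.capacityExpr L = C) (hC0 : 0 ≤ C)
    {κ : ℝ} (hκ : 0 < κ) {δ : ℝ} (hδ : 0 < δ) :
    ∃ c₂ : ℝ, 0 < c₂ ∧ ∃ n₀ : ℕ, ∀ n : ℕ, n₀ ≤ n →
      ∀ (M : ℕ) (φ : Fin M → Fin n → X), A.InputFeasible φ → C + δ ≤ rate n M →
        ∃ q : (Fin n → S) → ℝ, A.IsJammingStrategy κ q ∧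
          ∀ ψ : (Fin n → Y) → Finset (Fin M), IsListDecoder L ψ →
            c₂ ≤ ∑ s, q s * A.errorProb φ ψ s := by
  have hL0 : (1 : ℝ) ≤ L := by exact_mod_cast hL
  have hl2 : 0 < Real.log 2 := Real.log_pos one_lt_two
  -- The error guaranteed on the subcode: the first entry comes from Fano, the second from list
  -- jamming. Half of it, `η`, is given up to enforce feasibility.
  set β : ℝ := min (δ / (4 * (C + δ))) (1 / (2 * (L + 1))) with hβ
  have hβ0 : 0 < β := by positivity
  have hβ1 : β ≤ 1 := (min_le_right _ _).trans (by rw [div_le_one (by positivity)]; linarith)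
  set η : ℝ := β / 2 with hη
  have hη0 : 0 < η := by positivity
  set ε : ℝ := η * κ / (2 * (Fintype.card S * L * Fintype.card X + 1)) with hε
  have hε0 : 0 < ε := by positivity
  set μ : ℝ := (min (ε / 4) 1) ^ ⌈1 / (ε / 2) ^ 2⌉₊ with hμ
  have hμ0 : 0 < μ := by positivity
  have hμ1 : Real.log μ ≤ 0 :=
    Real.log_nonpos hμ0.le (pow_le_one₀ (by positivity) (min_le_right _ _))
  -- All losses that do not grow with `n`: Fano's 1, the list size, the density of the subcode and
  -- the size needed for distinct lists. Large `n` makes `K` at most a quarter of the rate excess.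
  set K : ℝ := 1 + Real.log L - Real.log μ + Real.log (2 * L * (L + 1)) with hK
  have hlogL : 0 ≤ Real.log L := Real.log_nonneg hL0
  have hlogLL : 0 ≤ Real.log (2 * L * (L + 1)) := Real.log_nonneg (by nlinarith)
  refine ⟨μ * η, by positivity, max 1 (max ⌈4 * K / (δ * Real.log 2)⌉₊
    ⌈(2 * Fintype.card S / (η * κ)) ^ 2⌉₊), fun n hn M φ hφ hrate => ?_⟩
  rw [max_le_iff, max_le_iff, Nat.ceil_le, Nat.ceil_le] at hn
  obtain ⟨hn1, hn2, hn3⟩ := hn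
  have hn0 : (0 : ℝ) < n := by exact_mod_cast hn1
  rw [div_le_iff₀ (by positivity)] at hn2
  rw [rate, le_div_iff₀ hn0, Real.logb, le_div_iff₀ hl2] at hrate
  set t : ℝ := n * Real.log 2 with ht
  have ht0 : 0 < t := by positivity
  have hlogM : t * (C + δ) ≤ Real.log M := by rw [ht]; linarith
  have hKt : K ≤ t * (δ / 4) := by rw [ht]; linarith
  have hM : 0 < M := by
    -- Since `Real.log 0 = 0`, a positive rate excludes the empty code.
    rcases Nat.eq_zero_or_pos M with rfl | h
    · have : 0 < t * (C + δ) := by positivity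
      simp only [Nat.cast_zero, Real.log_zero] at hlogM
      linarith
    · exact h
  have hM0 : (0 : ℝ) < M := by exact_mod_cast hM
  have : Nonempty (Fin M) := ⟨⟨0, hM⟩⟩
  obtain ⟨B, hB, hBcard, hBconc⟩ := exists_concentrated_subcode hn1 φ hε0
  rw [← hμ, Fintype.card_fin] at hBcard
  have : Nonempty B := hB.to_subtype
  have hB0 : (0 : ℝ) < B.card := by exact_mod_cast hB.card_pos
  have hlogB : Real.log μ + t * (C + δ) ≤ Real.log B.card := by
    have := Real.log_le_log (by positivity) hBcard
    rw [Real.log_mul hμ0.ne' hM0.ne'] at this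
    linarith
  have htC : 0 ≤ t * C := by positivity
  have hlogBL : t * (C + 3 * δ / 4) + 1 ≤ Real.log (B.card / L) := by
    rw [Real.log_div hB0.ne' (by positivity)]
    linarith
  have hBL : 2 * L * (L + 1) ≤ Fintype.card B := by
    rw [Fintype.card_coe]
    have : ((2 * L * (L + 1) : ℕ) : ℝ) ≤ B.card := by
      push_cast
      rw [← Real.log_le_log_iff (by positivity) hB0]
      have : 0 ≤ t * δ := by positivity
      linarith
    exact_mod_cast this
  have hden : 0 < t * (C + 3 * δ / 4) + 1 := by positivity
  -- The excess δ is split: the subcode keeps at least C + 3δ/4, the jammer attains information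
  -- below C + δ/2, and the gap δ/4 drives Fano's inequality.
  have hC2 : A.capacityExpr L < ((C + δ / 2 : ℝ) : EReal) := by
    rw [hC, EReal.coe_lt_coe_iff]
    linarith
  obtain ⟨q₀, hq₀, Q, hQ, hdist, herr⟩ := A.exists_stateLaw (φ := fun m : B => φ m) hn1 hL
    (by positivity) hBconc (fun m => hφ m) hC2 hBL
    (by rw [Fintype.card_coe]; exact hden.trans_le hlogBL)
  have hdist' : ∑ s, q₀ s * l1Dist (typeOf s) Q ≤ η * κ := by
    refine hdist.trans ?_
    have h1 : (Fintype.card S : ℝ) / √n ≤ η * κ / 2 := by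
      have h2 : 2 * Fintype.card S / (η * κ) ≤ √n := Real.le_sqrt_of_sq_le hn3
      rw [div_le_iff₀ (by positivity)] at h2
      rw [div_le_iff₀ (by positivity)]
      linarith
    have h3 : (Fintype.card S : ℝ) * (L * (ε * Fintype.card X)) ≤ η * κ / 2 := by
      have h4 : ε * (2 * (Fintype.card S * L * Fintype.card X + 1)) = η * κ := by
        rw [hε]; field_simp
      linarith
    linarith
  obtain ⟨q, hq, hqe⟩ := A.exists_isJammingStrategy hκ (by linarith) hq₀ hQ hdist'
  refine ⟨q, hq, fun ψ hψ => ?_⟩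
  set ψ' : (Fin n → Y) → Finset B := fun y => (ψ y).subtype (· ∈ B) with hψ'
  have h1 := herr ψ' fun y => by
    rw [hψ', Finset.card_subtype]
    exact (Finset.card_filter_le _ _).trans (hψ y)
  have h2 := hqe (A.meanError (fun m : B => φ m) ψ') (fun s => (A.meanError_mem_Icc _ _ s).1)
    (fun s => (A.meanError_mem_Icc _ _ s).2)
  have h3 : β ≤ ∑ s, q₀ s * A.meanError (fun m : B => φ m) ψ' s := by
    refine le_trans (le_min ((min_le_left _ _).trans ?_) (min_le_right _ _)) h1
    rw [Fintype.card_coe, ← ht]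
    have h4 : (t * (C + δ / 2) + 1) / Real.log (B.card / L)
        ≤ (t * (C + δ / 2) + 1) / (t * (C + 3 * δ / 4) + 1) :=
      div_le_div_of_nonneg_left (by positivity) hden hlogBL
    have h5 : δ / (4 * (C + δ)) ≤ 1 - (t * (C + δ / 2) + 1) / (t * (C + 3 * δ / 4) + 1) := by
      rw [one_sub_div hden.ne', div_le_div_iff₀ (by positivity) hden]
      have h6 : t * (C + 3 * δ / 4) + 1 ≤ t * (C + δ) := by linarith
      have h7 := mul_le_mul_of_nonneg_left h6 hδ.le
      linarith
    linarith
  have h4 : η ≤ ∑ s, q s * A.meanError (fun m : B => φ m) ψ' s := by linarith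
  have h5 : μ ≤ B.card / M := by rwa [le_div_iff₀ hM0]
  calc μ * η ≤ (B.card / M : ℝ) * ∑ s, q s * A.meanError (fun m : B => φ m) ψ' s :=
        mul_le_mul h5 h4 hη0.le (by positivity)
    _ = ∑ s, q s * ((B.card / M : ℝ) * A.meanError (fun m : B => φ m) ψ' s) := by
        rw [Finset.mul_sum]
        exact Finset.sum_congr rfl fun s _ => mul_left_comm _ _ _
    _ ≤ _ := Finset.sum_le_sum fun s _ =>
        mul_le_mul_of_nonneg_left (A.mul_meanError_le_errorProb φ ψ s B hB) (hq.1.1 s)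

end

end ObliviousAVC

end ObliAVC

end

/-- The converse. The subcode and the universal time-sharing sequence are provided unconditionally by
`ObliAVC.exists_concentrated_subcode`: the coordinates themselves serve as time-sharing variable, with
the empirical column distributions of the subcode. Hence `hconj` is not needed. -/
theorem mainTheorem3 {X S Y : Type*} [Fintype X] [Fintype S] [Fintype Y]
    (A : ObliAVC.ObliviousAVC X S Y) (L : ℕ) (hL : 1 ≤ L)
    (hLcp : A.cpSymmetrizability < (L : ℕ∞))
    (hconj : ObliAVC.SubcodeConjecture X L) :
    (∀ κ : ℝ, 0 < κ → A.capacity L κ ≤ A.capacityExpr L) ∧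
    ∀ κ : ℝ, 0 < κ → ∀ δ : ℝ, 0 < δ →
      ∃ c₂ : ℝ, 0 < c₂ ∧ ∃ n₀ : ℕ, ∀ n : ℕ, n₀ ≤ n →
        ∀ (M : ℕ) (φ : Fin M → Fin n → X), A.InputFeasible φ →
          A.capacityExpr L + (δ : EReal) ≤ ((ObliAVC.ObliviousAVC.rate n M : ℝ) : EReal) →
          ∃ q : (Fin n → S) → ℝ, A.IsJammingStrategy κ q ∧
            ∀ ψ : (Fin n → Y) → Finset (Fin M),
              ObliAVC.ObliviousAVC.IsListDecoder L ψ →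
                c₂ ≤ ∑ s, q s * A.errorProb φ ψ s ∧
                c₂ ≤ A.avgErrorProb κ φ ψ := by
  have h0 := A.capacityExpr_nonneg hL hLcp
  have converse : ∀ κ : ℝ, 0 < κ → ∀ δ : ℝ, 0 < δ →
      ∃ c₂ : ℝ, 0 < c₂ ∧ ∃ n₀ : ℕ, ∀ n : ℕ, n₀ ≤ n →
        ∀ (M : ℕ) (φ : Fin M → Fin n → X), A.InputFeasible φ →
          A.capacityExpr L + (δ : EReal) ≤ ((ObliAVC.ObliviousAVC.rate n M : ℝ) : EReal) →
          ∃ q : (Fin n → S) → ℝ, A.IsJammingStrategy κ q ∧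
            ∀ ψ : (Fin n → Y) → Finset (Fin M),
              ObliAVC.ObliviousAVC.IsListDecoder L ψ →
                c₂ ≤ ∑ s, q s * A.errorProb φ ψ s ∧
                c₂ ≤ A.avgErrorProb κ φ ψ := by
    intro κ hκ δ hδ
    by_cases htop : A.capacityExpr L = ⊤
    · refine ⟨1, one_pos, 0, fun n _ M φ _ h => ?_⟩
      rw [htop, EReal.top_add_coe, top_le_iff] at h
      exact absurd h (EReal.coe_ne_top _)
    · have hC : A.capacityExpr L = ((A.capacityExpr L).toReal : EReal) :=
        (EReal.coe_toReal htop fun hbot => by simp [hbot] at h0).symm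
      obtain ⟨c₂, hc, n₀, h⟩ := A.exists_jamming hL hC (EReal.toReal_nonneg h0) hκ hδ
      refine ⟨c₂, hc, n₀, fun n hn M φ hφ hrate => ?_⟩
      rw [hC, ← EReal.coe_add, EReal.coe_le_coe_iff] at hrate
      obtain ⟨q, hq, hψ⟩ := h n hn M φ hφ hrate
      exact ⟨q, hq, fun ψ hd => ⟨hψ ψ hd,
        (hψ ψ hd).trans (A.sum_mul_errorProb_le_avgErrorProb hq φ ψ)⟩⟩
  refine ⟨fun κ hκ => iSup₂_le fun R hR => ?_, converse⟩
  by_contra! hlt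
  have htop : A.capacityExpr L ≠ ⊤ := fun h => by simp [h] at hlt
  have hC : A.capacityExpr L = ((A.capacityExpr L).toReal : EReal) :=
    (EReal.coe_toReal htop fun hbot => by simp [hbot] at h0).symm
  set C := (A.capacityExpr L).toReal
  rw [hC, EReal.coe_lt_coe_iff] at hlt
  -- An achievable rate above `C` would have error at least `c₂` at all large blocklengths, against
  -- convergence to 0.
  obtain ⟨c₂, hc, n₀, h⟩ := converse κ hκ (R - C) (sub_pos.2 hlt)
  obtain ⟨n, M, φ, ψ, hn, -, -, hφ, hψ, hrate, hlim⟩ := hR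
  obtain ⟨i, hi, hin⟩ := ((hlim.eventually_lt_const hc).and
    (hn.tendsto_atTop.eventually_ge_atTop n₀)).exists
  obtain ⟨q, -, hq⟩ := h (n i) hin (M i) (φ i) (hφ i) (by
    rw [hC, ← EReal.coe_add, EReal.coe_le_coe_iff, add_sub_cancel]
    exact hrate i)
  exact (hq (ψ i) (hψ i)).2.not_gt hi
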